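/- Conventions. A finite binary tree is a non-empty finite prefix-closed set $T\subseteq\{0,1\}^*$; its frontier is $\mathrm{fr}(T)=T\{0,1\}\setminus T$. For a finite alphabet $\Sigma$, a finite $\Sigma$-labeled binary tree is a pair $t=(T,\lambda)$ with $T$ a finite binary tree and $\lambda:T\to\Sigma$. A tree automaton over $\Sigma$ is a tuple $(Q,\Delta,I,F)$ with $Q$ a finite set, $I,F\subseteq Q$ and $\Delta\subseteq (Q\setminus F)\times\Sigma\times Q\times Q$; it accepts $t=(T,\lambda)$ if there is a map $\rho:T\cup\mathrm{fr}(T)\to Q$ with $\rho(\varepsilon)\in I$, $\rho(\mathrm{fr}(T))\subseteq F$ and $(\rho(d),\lambda(d),\rho(d0),\rho(d1))\in\Delta$ for all $d\in T$. A set of $\Sigma$-labeled trees is regular if it is the set of trees accepted by some tree automaton over $\Sigma$. With a new symbol $\diamond\notin\Sigma$, the convolution $t_1\otimes t_2$ of $t_i=(T_i,\lambda_i)$ is the $(\Sigma\cup\{\diamond\})^2$-labeled tree with set of nodes $T_1\cup T_2$ in which $u$ has the label $(\lambda_1'(u),\lambda_2'(u))$, where $\lambda_i'(u)=\lambda_i(u)$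 if $u\in T_i$ and $\lambda_i'(u)=\diamond$ otherwise. A partial order is tree-automatic if it is isomorphic to some $(S,\le)$ where, for some finite alphabet $\Sigma$, $S$ is a regular set of finite $\Sigma$-labeled binary trees and $\{s\otimes t : s,t\in S,\ s\le t\}$ is regular. A partial order $(P,\le)$ is well-founded if it has no infinite strictly descending chain. It is upwards linear if for every $p\in P$ the set $\{a\in P: p<a\}$ is linearly ordered by $\le$; it is a forest if moreover each of these sets is finite, and a tree if it is a forest with a greatest element. A wulpo is a well-founded upwards linear partial order. For a well-founded partial order $P$ put $\mathrm{rank}(p)=\sup\{\mathrm{rank}(q)+1: q<p\}$ for $p\in P$ and $\mathrm{rank}(P)=\sup\{\mathrm{rank}(p)+1: p\in P\}$, where $\sup\emptyset=0$. Theorem. (1) Every tree-automatic wulpo has rank strictly below $\omega^{\omega^\omega}$. (2) Every tree-automatic well-founded forest, and in particular every tree-automatic well-founded tree, has rank strictly below $\omega^\omega$. -/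

import Mathlib

open scoped Ordinal

universe u

namespace TreeAutomatic

/-- A finite `A`-labeled binary tree `(T, l)`: `T` is a nonempty finite prefix-closed set of words
over `{0,1}` (here `List Bool`) and `l : T → A`. The pair is encoded by the partial function
`label`, whose value is `none` exactly outside `T`. -/
@[ext]
structure LabeledTree (A : Type) where
  label : List Bool → Option A
  finite_nodes : {w : List Bool | label w ≠ none}.Finite
  prefix_closed : ∀ v w : List Bool, v <+: w → label w ≠ none → label v ≠ none
  root_mem : label [] ≠ none

namespace LabeledTree

variable {A : Type}

/-- The set `T` of nodes. -/
def nodes (t : LabeledTree A) : Set (List Bool) := {w | t.label w ≠ none}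

/-- The frontier `T{0,1} \ T`. -/
def frontier (t : LabeledTree A) : Set (List Bool) :=
  {w | (∃ v ∈ t.nodes, ∃ b : Bool, w = v ++ [b]) ∧ w ∉ t.nodes}

open Classical in
/-- The convolution of a nonempty tuple of trees. Its nodes are all nodes of the given trees; the
`i`-th component of a label is `none` (the padding symbol) outside the `i`-th tree. -/
noncomputable def convolution {n : ℕ} [NeZero n] (t : Fin n → LabeledTree A) :
    LabeledTree (Fin n → Option A) where
  label w := if ∃ i, w ∈ (t i).nodes then some (fun i => (t i).label w) else none
  finite_nodes := by
    refine (Set.finite_iUnion fun i => (t i).finite_nodes).subset fun w hw => ?_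
    by_contra h
    refine hw (if_neg ?_)
    rintro ⟨i, hi⟩
    exact h (Set.mem_iUnion.2 ⟨i, hi⟩)
  prefix_closed := by
    intro v w hvw hw
    have h : ∃ i, w ∈ (t i).nodes := by
      by_contra h
      exact hw (if_neg h)
    obtain ⟨i, hi⟩ := h
    rw [if_pos ⟨i, (t i).prefix_closed v w hvw hi⟩]
    exact Option.some_ne_none _
  root_mem := by
    rw [if_pos ⟨0, (t 0).root_mem⟩]
    exact Option.some_ne_none _

end LabeledTree

/-- A (top-down, nondeterministic) tree automaton over the alphabet `A` with state set `Q`;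
no transition starts in a final state. -/
structure TreeAutomaton (A Q : Type) where
  trans : Set (Q × A × Q × Q)
  init : Set Q
  final : Set Q
  source_not_final : ∀ q a q₀ q₁, (q, a, q₀, q₁) ∈ trans → q ∉ final

namespace TreeAutomaton

variable {A Q : Type}

/-- `ρ` is a successful run on `t`. Only the values of `ρ` on the nodes of `t` and on its frontier
matter. -/
structure IsSuccessfulRun (M : TreeAutomaton A Q) (t : LabeledTree A) (ρ : List Bool → Q) :
    Prop where
  root : ρ [] ∈ M.init
  frontier : ∀ w ∈ t.frontier, ρ w ∈ M.final
  step : ∀ w a, t.label w = some a → (ρ w, a, ρ (w ++ [false]), ρ (w ++ [true])) ∈ M.trans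

/-- The set of trees that admit a successful run. -/
def language (M : TreeAutomaton A Q) : Set (LabeledTree A) :=
  {t | ∃ ρ, M.IsSuccessfulRun t ρ}

end TreeAutomaton

/-- A set of trees is regular if it is the language of a tree automaton with finitely many
states. -/
def IsRegular {A : Type} (L : Set (LabeledTree A)) : Prop :=
  ∃ (Q : Type) (_ : Finite Q) (M : TreeAutomaton A Q), M.language = L

/-- An `n`-ary relation on trees is tree-automatic if the set of convolutions of its tuples is
regular. -/
def IsTreeAutomaticRel {A : Type} {n : ℕ} [NeZero n] (R : Set (Fin n → LabeledTree A)) : Prop :=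
  IsRegular (LabeledTree.convolution '' R)

/-- The structure `(P, ≤)` is tree-automatic: it is isomorphic, via `e`, to a structure whose
domain is a regular set of trees over a finite alphabet and whose order is a tree-automatic
relation. -/
def IsTreeAutomaticOrder (P : Type u) [LE P] : Prop :=
  ∃ (A : Type) (_ : Finite A) (e : P → LabeledTree A),
    Function.Injective e ∧
    IsRegular (Set.range e) ∧
    IsTreeAutomaticRel {t : Fin 2 → LabeledTree A | ∃ p q : P, p ≤ q ∧ t = ![e p, e q]}

/-- The elements strictly above any given element form a linear order. -/
def IsUpwardsLinear (P : Type u) [PartialOrder P] : Prop :=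
  ∀ p : P, IsChain (· ≤ ·) (Set.Ioi p)

/-- The elements strictly above any given element form a finite linear order. -/
def IsForest (P : Type u) [PartialOrder P] : Prop :=
  IsUpwardsLinear P ∧ ∀ p : P, (Set.Ioi p).Finite

/-- A forest with a greatest element. -/
def IsOrderTree (P : Type u) [PartialOrder P] : Prop :=
  IsForest P ∧ ∃ r : P, IsTop r

/-- The ordinal rank (height) `sup {rank p + 1 | p ∈ P}` of a well-founded partial order; the rank
of an element is `rank p = sup {rank q + 1 | q < p}`. -/
noncomputable def orderRank (P : Type u) [PartialOrder P] [WellFoundedLT P] : Ordinal.{u} :=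
  ⨆ p : P, Order.succ (IsWellFounded.rank (α := P) (· < ·) p)

end TreeAutomatic

/-! Fix `p`. The tree of an element `x ≤ p` consists of its labels over the nodes of the tree of `p`
and of one part hanging at each frontier word. Whether two trees are related depends only on the
labels over those nodes and on the colours of corresponding parts, a colour being the set of states
that accept the convolution of two parts. Hence `Set.Iic p` is a finite union of boxes
(`isBox_piece`): products whose order is read off from the colours of pairs of coordinates. The
order on a coordinate lies inside one of finitely many relations that do not depend on `p`
(`exists_heights`). So a single `m` serves all `p`: once the rank of `p` is below some `b n`, all
coordinates have rank at most `b m` (`exists_box_decomposition`).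

It remains to bound a box by its coordinates (`IsBox.rankLE`). Along a descending sequence, record
in each coordinate the antichain of minimal values seen so far. Upward linearity bounds its size by
the number of colours (`History.card_le`), so a natural-sum measure falls whenever an antichain
changes (`History.step`). While the antichains stay fixed, the sequence moves in a region that is
small: it is controlled by finitely many products of chains in general (`rankLE_region`), and it is
finite in a forest (`region_finite`).

If the rank of the order were too large, some `p` would have rank exactly `b (m + 2)`. But the boxes
below `p` have smaller rank, and so does their finite union (`rankLE_iUnion`). -/

namespace TreeAutomatic

open Order

/-! ### Natural sums and powers of `ω` -/

/-- The natural (Hessenberg) sum of two ordinals. -/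
noncomputable def nadd (a b : Ordinal.{u}) : Ordinal.{u} :=
  max (⨆ x : Set.Iio a, succ (nadd x.1 b)) (⨆ x : Set.Iio b, succ (nadd a x.1))
termination_by (a, b)
decreasing_by all_goals cases x; decreasing_tactic

theorem nadd_le_iff {a b c : Ordinal.{u}} :
    nadd a b ≤ c ↔ (∀ a' < a, nadd a' b < c) ∧ ∀ b' < b, nadd a b' < c := by
  rw [nadd, max_le_iff, Ordinal.iSup_le_iff, Ordinal.iSup_le_iff]
  simp only [succ_le_iff, Subtype.forall, Set.mem_Iio]

theorem nadd_lt_nadd_right {a a' : Ordinal.{u}} (h : a' < a) (b : Ordinal.{u}) :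
    nadd a' b < nadd a b :=
  (nadd_le_iff.1 le_rfl).1 a' h

theorem nadd_lt_nadd_left {b b' : Ordinal.{u}} (h : b' < b) (a : Ordinal.{u}) :
    nadd a b' < nadd a b :=
  (nadd_le_iff.1 le_rfl).2 b' h

theorem nadd_le_nadd_right {a a' : Ordinal.{u}} (h : a' ≤ a) (b : Ordinal.{u}) :
    nadd a' b ≤ nadd a b := by
  rcases h.eq_or_lt with rfl | h
  · exact le_rfl
  · exact (nadd_lt_nadd_right h b).le

theorem nadd_le_nadd_left {b b' : Ordinal.{u}} (h : b' ≤ b) (a : Ordinal.{u}) :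
    nadd a b' ≤ nadd a b := by
  rcases h.eq_or_lt with rfl | h
  · exact le_rfl
  · exact (nadd_lt_nadd_left h a).le

theorem nadd_comm_le (a b : Ordinal.{u}) : nadd a b ≤ nadd b a := by
  refine nadd_le_iff.2 ⟨fun a' h => ?_, fun b' h => ?_⟩
  · exact (nadd_comm_le a' b).trans_lt (nadd_lt_nadd_left h b)
  · exact (nadd_comm_le a b').trans_lt (nadd_lt_nadd_right h a)
termination_by (a, b)

theorem nadd_comm (a b : Ordinal.{u}) : nadd a b = nadd b a :=
  (nadd_comm_le a b).antisymm (nadd_comm_le b a)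

theorem nadd_zero (a : Ordinal.{u}) : nadd a 0 = a := by
  induction a using WellFoundedLT.induction with
  | ind a ih =>
    refine le_antisymm (nadd_le_iff.2 ⟨fun a' h => ?_, fun b' h => ?_⟩) ?_
    · rwa [ih a' h]
    · exact absurd h (not_lt.2 zero_le)
    · refine le_of_forall_lt fun c hc => ?_
      rw [← ih c hc]
      exact nadd_lt_nadd_right hc 0

theorem lt_nadd_iff {a b c : Ordinal.{u}} :
    c < nadd a b ↔ (∃ a' < a, c ≤ nadd a' b) ∨ ∃ b' < b, c ≤ nadd a b' := by
  rw [← not_le, nadd_le_iff]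
  simp only [not_and_or, not_forall, not_lt, exists_prop]

theorem nadd_assoc_le (a b c : Ordinal.{u}) : nadd (nadd a b) c ≤ nadd a (nadd b c) := by
  refine nadd_le_iff.2 ⟨fun d h => ?_, fun c' h => ?_⟩
  · rcases lt_nadd_iff.1 h with ⟨a', ha, hd⟩ | ⟨b', hb, hd⟩
    · exact ((nadd_le_nadd_right hd c).trans (nadd_assoc_le a' b c)).trans_lt
        (nadd_lt_nadd_right ha _)
    · exact ((nadd_le_nadd_right hd c).trans (nadd_assoc_le a b' c)).trans_lt
        (nadd_lt_nadd_left (nadd_lt_nadd_right hb c) a)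
  · exact (nadd_assoc_le a b c').trans_lt (nadd_lt_nadd_left (nadd_lt_nadd_left h b) a)
termination_by (a, b, c)

theorem nadd_assoc (a b c : Ordinal.{u}) : nadd (nadd a b) c = nadd a (nadd b c) := by
  refine (nadd_assoc_le a b c).antisymm ?_
  calc nadd a (nadd b c) = nadd (nadd c b) a := by rw [nadd_comm a, nadd_comm b]
    _ ≤ nadd c (nadd b a) := nadd_assoc_le c b a
    _ = nadd (nadd a b) c := by rw [nadd_comm c, nadd_comm b]

/-- The ordinals, with the natural sum as addition. -/
def NatOrd : Type (u + 1) := Ordinal.{u}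

namespace NatOrd

noncomputable instance : LinearOrder NatOrd.{u} := inferInstanceAs (LinearOrder Ordinal.{u})

instance : WellFoundedLT NatOrd.{u} := inferInstanceAs (WellFoundedLT Ordinal.{u})

/-- An ordinal, seen in `NatOrd`. -/
def of (a : Ordinal.{u}) : NatOrd.{u} := a

/-- The ordinal underlying an element of `NatOrd`. -/
def ord (a : NatOrd.{u}) : Ordinal.{u} := a

theorem of_lt_of {a b : Ordinal.{u}} : of a < of b ↔ a < b := Iff.rfl

theorem of_le_of {a b : Ordinal.{u}} : of a ≤ of b ↔ a ≤ b := Iff.rfl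

theorem ord_lt_ord {a b : NatOrd.{u}} : a.ord < b.ord ↔ a < b := Iff.rfl

theorem ord_le_ord {a b : NatOrd.{u}} : a.ord ≤ b.ord ↔ a ≤ b := Iff.rfl

noncomputable instance : Add NatOrd.{u} := ⟨fun a b => of (nadd a.ord b.ord)⟩

instance : Zero NatOrd.{u} := ⟨of 0⟩

noncomputable instance : AddCommMonoid NatOrd.{u} where
  add_assoc a b c := nadd_assoc a.ord b.ord c.ord
  add_comm a b := nadd_comm a.ord b.ord
  add_zero a := nadd_zero a.ord
  zero_add a := (nadd_comm 0 a.ord).trans (nadd_zero a.ord)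
  nsmul := nsmulRec

instance : IsOrderedCancelAddMonoid NatOrd.{u} where
  add_le_add_left a b h c := nadd_le_nadd_right (a := b.ord) (a' := a.ord) h c.ord
  le_of_add_le_add_left a b c h :=
    le_of_not_gt fun hlt =>
      absurd h (not_le.2 (nadd_lt_nadd_left (b := b.ord) (b' := c.ord) hlt a.ord))

theorem zero_le' (a : NatOrd.{u}) : 0 ≤ a := zero_le (a := a.ord)

end NatOrd

/-- A smaller argument either loses a multiple of `ω ^ t`, and the remainders, whose natural sum is
below `ω ^ t`, fit into the gap; or it keeps the multiple and has a smaller remainder. -/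
theorem nadd_mul_add_le {t : Ordinal.{u}}
    (ht : ∀ a < ω ^ t, ∀ b < ω ^ t, nadd a b < (ω : Ordinal.{u}) ^ t)
    (a b : Ordinal.{u}) : ∀ (n m : ℕ) (c d : Ordinal.{u}), c < ω ^ t → d < ω ^ t →
      a = ω ^ t * n + c → b = ω ^ t * m + d →
      nadd a b ≤ ω ^ t * ((n + m : ℕ) : Ordinal.{u}) + nadd c d := by
  have hpos : (ω : Ordinal.{u}) ^ t ≠ 0 := Ordinal.opow_ne_zero _ Ordinal.omega0_ne_zero
  have split : ∀ (n : ℕ) (c x : Ordinal.{u}), c < ω ^ t → x < ω ^ t * n + c →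
      ∃ (n' : ℕ) (c' : Ordinal.{u}), c' < ω ^ t ∧ x = ω ^ t * n' + c' ∧
        (n' < n ∨ n' = n ∧ c' < c) := by
    intro n c x hc hx
    have h1 : x / ω ^ t < ((n + 1 : ℕ) : Ordinal.{u}) := by
      rw [← Ordinal.lt_mul_iff_div_lt hpos]
      refine hx.trans ?_
      push_cast
      rw [mul_add, mul_one]
      gcongr
    obtain ⟨n', hn'⟩ := Ordinal.lt_omega0.1 (h1.trans (Ordinal.natCast_lt_omega0 _))
    have hx' : x = ω ^ t * n' + x % ω ^ t := by
      rw [← hn', Ordinal.div_add_mod]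
    refine ⟨n', x % ω ^ t, Ordinal.mod_lt _ hpos, hx', ?_⟩
    rw [hn', Nat.cast_lt] at h1
    rcases (Nat.lt_succ_iff.1 h1).lt_or_eq with h | rfl
    · exact Or.inl h
    · right
      refine ⟨rfl, ?_⟩
      rw [hx'] at hx
      exact (add_lt_add_iff_left _).1 hx
  have jump : ∀ (k l : ℕ) (e f : Ordinal.{u}), e < ω ^ t → k < l →
      ω ^ t * (k : Ordinal.{u}) + e < ω ^ t * (l : Ordinal.{u}) + f := by
    intro k l e f he hkl
    calc ω ^ t * (k : Ordinal.{u}) + e < ω ^ t * (k : Ordinal.{u}) + ω ^ t := by gcongr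
      _ = ω ^ t * ((k + 1 : ℕ) : Ordinal.{u}) := by push_cast; rw [mul_add, mul_one]
      _ ≤ ω ^ t * (l : Ordinal.{u}) := by
        gcongr
        exact_mod_cast hkl
      _ ≤ _ := le_self_add
  induction a using WellFoundedLT.induction generalizing b with
  | ind a iha =>
    induction b using WellFoundedLT.induction with
    | ind b ihb =>
      rintro n m c d hc hd ha hb
      refine nadd_le_iff.2 ⟨fun x hx => ?_, fun x hx => ?_⟩
      · obtain ⟨n', c', hc', hx', h⟩ := split n c x hc (ha ▸ hx)
        refine (iha x hx b n' m c' d hc' hd hx' hb).trans_lt ?_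
        rcases h with h | ⟨rfl, h⟩
        · exact jump _ _ _ _ (ht c' hc' d hd) (by omega)
        · gcongr
          exact nadd_lt_nadd_right h d
      · obtain ⟨m', d', hd', hx', h⟩ := split m d x hd (hb ▸ hx)
        refine (ihb x hx n m' c d' hc hd' ha hx').trans_lt ?_
        rcases h with h | ⟨rfl, h⟩
        · exact jump _ _ _ _ (ht c hc d' hd') (by omega)
        · gcongr
          exact nadd_lt_nadd_left h c

theorem nadd_lt_omega0_opow (s : Ordinal.{u}) :
    ∀ a < ω ^ s, ∀ b < ω ^ s, nadd a b < (ω : Ordinal.{u}) ^ s := by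
  induction s using WellFoundedLT.induction with
  | ind s ih =>
    intro a ha b hb
    rcases eq_or_ne s 0 with rfl | hs
    · rw [Ordinal.opow_zero, Order.lt_one_iff] at ha hb
      rw [ha, hb, nadd_zero, Ordinal.opow_zero]
      exact zero_lt_one
    · obtain ⟨t, ht, n, hn⟩ := (Ordinal.lt_omega0_opow hs).1 (max_lt ha hb)
      have h := nadd_mul_add_le (ih t ht) _ _ n n 0 0
        (Ordinal.opow_pos _ Ordinal.omega0_pos) (Ordinal.opow_pos _ Ordinal.omega0_pos) rfl rfl
      rw [nadd_zero, add_zero, add_zero] at h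
      calc nadd a b ≤ nadd (ω ^ t * n) b := nadd_le_nadd_right ((le_max_left _ _).trans hn.le) b
        _ ≤ nadd (ω ^ t * n) (ω ^ t * n) := nadd_le_nadd_left ((le_max_right _ _).trans hn.le) _
        _ ≤ _ := h
        _ < ω ^ s := Ordinal.opow_mul_lt_opow (Ordinal.natCast_lt_omega0 _) ht

theorem NatOrd.sum_lt_omega0_opow {ι : Type*} (I : Finset ι) {s : Ordinal.{u}} {f : ι → NatOrd.{u}}
    (h : ∀ i ∈ I, f i < of (ω ^ s)) : ∑ i ∈ I, f i < of (ω ^ s) := by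
  classical
  induction I using Finset.induction_on with
  | empty => exact Ordinal.opow_pos _ Ordinal.omega0_pos
  | insert i I hi ih =>
    rw [Finset.sum_insert hi]
    exact nadd_lt_omega0_opow s _ (h i (Finset.mem_insert_self _ _)) _
      (ih fun j hj => h j (Finset.mem_insert_of_mem hj))

theorem NatOrd.nsmul_lt_omega0_opow (n : ℕ) {s : Ordinal.{u}} {a : NatOrd.{u}}
    (h : a < of (ω ^ s)) : n • a < of (ω ^ s) := by
  have := sum_lt_omega0_opow (Finset.range n) (f := fun _ => a) fun _ _ => h
  rwa [Finset.sum_const, Finset.card_range] at this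

/-! ### Rank bounds: finite unions and finitely many coordinates -/

/-- The relation `r` on the set `S` has rank at most `α`: there is a map to the ordinals below `α`
that is strictly increasing on `S`. -/
def RankLE {X : Type*} (r : X → X → Prop) (S : Set X) (α : Ordinal.{u}) : Prop :=
  ∃ f : X → Ordinal.{u}, (∀ x ∈ S, ∀ y ∈ S, r x y → f x < f y) ∧ ∀ x ∈ S, f x < α

theorem RankLE.mono {X : Type*} {r : X → X → Prop} {S : Set X} {α β : Ordinal.{u}}
    (h : RankLE r S α) (hαβ : α ≤ β) : RankLE r S β := by
  obtain ⟨f, hf, hα⟩ := h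
  exact ⟨f, hf, fun x hx => (hα x hx).trans_le hαβ⟩

section Order

variable {P : Type u} [PartialOrder P]

theorem RankLE.rank_lt [WellFoundedLT P] {p : P} {α : Ordinal.{u}}
    (h : RankLE (· < ·) (Set.Iic p) α) : IsWellFounded.rank (α := P) (· < ·) p < α := by
  obtain ⟨f, hf, hα⟩ := h
  have key : ∀ x : P, x ≤ p → IsWellFounded.rank (α := P) (· < ·) x ≤ f x := by
    intro x
    induction x using WellFoundedLT.induction with
    | ind x ih =>
      intro hx
      rw [IsWellFounded.rank_eq]
      refine Ordinal.iSup_le fun ⟨y, hy⟩ => succ_le_of_lt ?_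
      have hyp : y ≤ p := (le_of_lt hy).trans hx
      exact (ih y hy hyp).trans_lt (hf y hyp x hx hy)
  exact (key p le_rfl).trans_lt (hα p le_rfl)

theorem rankLE_Iic [WellFoundedLT P] (p : P) :
    RankLE (· < ·) (Set.Iic p) (succ (IsWellFounded.rank (α := P) (· < ·) p)) :=
  ⟨IsWellFounded.rank (α := P) (· < ·), fun _ _ _ _ h => IsWellFounded.rank_lt_of_rel h,
    fun _ hx => lt_succ_of_le (WellFoundedLT.rank_strictMono.monotone hx)⟩

/-- The relation `<` with smaller elements restricted to `S`. -/
def ltOn (S : Set P) (x y : P) : Prop := x ∈ S ∧ x < y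

instance [WellFoundedLT P] (S : Set P) : IsWellFounded P (ltOn S) :=
  ⟨Subrelation.wf (fun h => h.2) (wellFounded_lt (α := P))⟩

theorem rankLE_of_rank_lt [WellFoundedLT P] {S : Set P} {β : Ordinal.{u}}
    (h : ∀ y ∈ S, IsWellFounded.rank (ltOn S) y < β) : RankLE (· < ·) S β :=
  ⟨IsWellFounded.rank (ltOn S), fun _ hx _ _ hxy => IsWellFounded.rank_lt_of_rel ⟨hx, hxy⟩, h⟩

theorem rankLE_of_below [WellFoundedLT P] {S : Set P} {β : Ordinal.{u}}
    (h : ∀ y ∈ S, ∃ α < β, RankLE (· < ·) {x ∈ S | x < y} α) : RankLE (· < ·) S β := by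
  refine rankLE_of_rank_lt fun y hy => ?_
  obtain ⟨α, hαβ, f, hf, hα⟩ := h y hy
  refine lt_of_le_of_lt ?_ hαβ
  have key : ∀ x : P, x ∈ S → x < y → IsWellFounded.rank (ltOn S) x ≤ f x := by
    intro x
    induction x using WellFoundedLT.induction with
    | ind x ih =>
      intro hxS hx
      rw [IsWellFounded.rank_eq]
      refine Ordinal.iSup_le fun ⟨z, hzS, hz⟩ => succ_le_of_lt ?_
      exact (ih z hz hzS (hz.trans hx)).trans_lt (hf z ⟨hzS, hz.trans hx⟩ x ⟨hxS, hx⟩ hz)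
  rw [IsWellFounded.rank_eq]
  refine Ordinal.iSup_le fun ⟨z, hzS, hz⟩ => succ_le_of_lt ?_
  exact (key z hzS hz).trans_lt (hα z ⟨hzS, hz⟩)

/-- Sum naturally over `i` the suprema of `succ (f i a)` over all `a ≤ x` in `S i`. Every summand is
monotone in `x`, and the summand of a set containing the larger element `y` increases strictly,
since all earlier values there lie below `f i y`. The condition `s ≠ 0` makes `ω ^ s` a limit, which
absorbs the final successor. -/
theorem rankLE_iUnion {ι : Type*} [Finite ι] {S : ι → Set P} {s : Ordinal.{u}} (hs : s ≠ 0)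
    (h : ∀ i, ∃ α < ω ^ s, RankLE (· < ·) (S i) α) {S' : Set P} (hS' : S' ⊆ ⋃ i, S i) :
    ∃ α < ω ^ s, RankLE (· < ·) S' α := by
  have := Fintype.ofFinite ι
  choose α hα f hf hfα using h
  let F : P → NatOrd.{u} := fun x =>
    ∑ i, NatOrd.of (⨆ a : {a : P // a ∈ S i ∧ a ≤ x}, succ (f i a.1))
  refine ⟨succ (∑ i, NatOrd.of (α i)).ord, ?_, fun x => (F x).ord, ?_, ?_⟩
  · refine (Ordinal.isSuccLimit_opow_left Ordinal.isSuccLimit_omega0 hs).succ_lt ?_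
    exact NatOrd.sum_lt_omega0_opow Finset.univ fun i _ => hα i
  · intro x hx y hy hxy
    obtain ⟨i₀, hi₀⟩ := Set.mem_iUnion.1 (hS' hy)
    refine NatOrd.ord_lt_ord.2 (Finset.sum_lt_sum (fun i _ => ?_) ⟨i₀, Finset.mem_univ _, ?_⟩)
    · refine NatOrd.of_le_of.2 (Ordinal.iSup_le fun a => ?_)
      exact Ordinal.le_iSup (fun a : {a : P // a ∈ S i ∧ a ≤ y} => succ (f i a.1))
        ⟨a.1, a.2.1, a.2.2.trans hxy.le⟩
    · refine NatOrd.of_lt_of.2 (lt_of_le_of_lt (Ordinal.iSup_le (a := f i₀ y) fun a => ?_) ?_)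
      · exact succ_le_of_lt (hf i₀ a.1 a.2.1 y hi₀ (a.2.2.trans_lt hxy))
      · exact (lt_succ _).trans_le
          (Ordinal.le_iSup (fun a : {a : P // a ∈ S i₀ ∧ a ≤ y} => succ (f i₀ a.1))
            ⟨y, hi₀, le_rfl⟩)
  · intro x hx
    refine lt_succ_of_le (NatOrd.ord_le_ord.2 (Finset.sum_le_sum fun i _ => ?_))
    exact NatOrd.of_le_of.2 (Ordinal.iSup_le fun a => succ_le_of_lt (hfα i a.1 a.2.1))

theorem rankLE_omega0_of_finite {S : Set P} (hS : S.Finite) :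
    RankLE (· < ·) S (ω : Ordinal.{u}) := by
  refine ⟨fun x => ({y ∈ S | y < x}.ncard : Ordinal.{u}), fun x hx y hy hxy => ?_,
    fun x _ => Ordinal.natCast_lt_omega0 _⟩
  refine Nat.cast_lt.2 (Set.ncard_lt_ncard ?_ (hS.subset fun z hz => hz.1))
  refine ⟨fun z hz => ⟨hz.1, hz.2.trans hxy⟩, fun h => ?_⟩
  exact lt_irrefl x (h ⟨hx, hxy⟩ : x ∈ S ∧ x < x).2

/-- A form of the bound by the natural product for well-founded extensions of products of
well-orders. -/
theorem rankLE_of_coordinates [WellFoundedLT P] {ι : Type*} [Fintype ι] (n : NatOrd.{u}) :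
    ∀ (δ : ι → Ordinal.{u}) (S : Set P) (g : ι → P → Ordinal.{u}),
      ∑ i, NatOrd.of (δ i) = n →
      (∀ x ∈ S, ∀ y ∈ S, x < y → ∃ i, g i x < g i y) →
      (∀ i, ∀ x ∈ S, g i x < ω ^ δ i) → RankLE (· < ·) S (ω ^ n.ord) := by
  classical
  induction n using WellFoundedLT.induction with
  | ind n ih =>
    intro δ S g hn hg hδ
    refine rankLE_of_below fun y hy => ?_
    rcases eq_or_ne n 0 with rfl | hn0
    · refine ⟨0, Ordinal.opow_pos _ Ordinal.omega0_pos, fun _ => 0, ?_, ?_⟩ <;>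
      · rintro x ⟨hx, hxy⟩
        exfalso
        obtain ⟨i, hi⟩ := hg x hx y hy hxy
        have h1 : NatOrd.of (δ i) ≤ 0 := by
          rw [← hn]
          exact Finset.single_le_sum (f := fun i => NatOrd.of (δ i))
            (fun j _ => NatOrd.zero_le' _) (Finset.mem_univ i)
        have h2 : δ i = 0 := le_antisymm h1 zero_le
        have h3 := hδ i y hy
        rw [h2, Ordinal.opow_zero, Order.lt_one_iff] at h3
        rw [h3] at hi
        exact absurd hi (not_lt.2 zero_le)
    -- An element below `y` has some coordinate `i` smaller than that of `y`, hence below `ω ^ ε i *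
    -- k i`, so its quotient by `ω ^ ε i` takes one of `k i` values. If `δ i = 0` the coordinate
    -- vanishes on `S` and cannot drop; the zeros are placeholders.
    · have key : ∀ i, ∃ ε k, (δ i ≠ 0 → ε < δ i) ∧
          (δ i ≠ 0 → g i y < ω ^ ε * ((k : ℕ) : Ordinal)) := by
        intro i
        rcases eq_or_ne (δ i) 0 with h | h
        · exact ⟨0, 0, fun h' => absurd h h', fun h' => absurd h h'⟩
        · obtain ⟨ε, hε, k, hk⟩ := (Ordinal.lt_omega0_opow h).1 (hδ i y hy)
          exact ⟨ε, k, fun _ => hε, fun _ => hk⟩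
      choose ε k hε hk using key
      have hpos : ∀ i, (ω : Ordinal.{u}) ^ ε i ≠ 0 := fun i =>
        Ordinal.opow_ne_zero _ Ordinal.omega0_ne_zero
      let T : (Σ i : {i // δ i ≠ 0}, Fin (k i.1)) → Set P := fun q =>
        {x ∈ S | g q.1.1 x / ω ^ ε q.1.1 = ((q.2 : ℕ) : Ordinal.{u})}
      refine rankLE_iUnion (ι := Σ i : {i // δ i ≠ 0}, Fin (k i.1)) (S := T) hn0 ?_ ?_
      · rintro ⟨⟨i, hi⟩, j⟩
        -- Where the quotient is constant only the remainder modulo `ω ^ ε i` matters, so the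
        -- exponent `δ i` drops to `ε i` and the natural sum decreases.
        have hlt : ∑ l, NatOrd.of (Function.update δ i (ε i) l) < n := by
          rw [← hn]
          refine Finset.sum_lt_sum (fun l _ => ?_) ⟨i, Finset.mem_univ _, ?_⟩
          · rcases eq_or_ne l i with rfl | hl
            · rw [Function.update_self]
              exact (hε l hi).le
            · rw [Function.update_of_ne hl]
          · rw [Function.update_self]
            exact hε i hi
        refine ⟨_, ?_, ih _ hlt (Function.update δ i (ε i)) _
          (Function.update g i fun x => g i x % ω ^ ε i) rfl ?_ ?_⟩
        · exact (Ordinal.opow_lt_opow_iff_right Ordinal.one_lt_omega0).2 hlt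
        · rintro x ⟨hx, hxj⟩ z ⟨hz, hzj⟩ hxz
          obtain ⟨l, hl⟩ := hg x hx z hz hxz
          refine ⟨l, ?_⟩
          rcases eq_or_ne l i with rfl | hli
          · simp only [Function.update_self]
            rw [← Ordinal.div_add_mod (g l x) (ω ^ ε l), ← Ordinal.div_add_mod (g l z) (ω ^ ε l),
              hxj, hzj] at hl
            exact (add_lt_add_iff_left _).1 hl
          · simpa only [Function.update_of_ne hli] using hl
        · rintro l x ⟨hx, -⟩
          rcases eq_or_ne l i with rfl | hli
          · simp only [Function.update_self]
            exact Ordinal.mod_lt _ (hpos l)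
          · simpa only [Function.update_of_ne hli] using hδ l x hx
      · rintro x ⟨hx, hxy⟩
        obtain ⟨i, hi⟩ := hg x hx y hy hxy
        have hi0 : δ i ≠ 0 := by
          intro h
          have h3 := hδ i y hy
          rw [h, Ordinal.opow_zero, Order.lt_one_iff] at h3
          rw [h3] at hi
          exact absurd hi (not_lt.2 zero_le)
        have h1 := (Ordinal.lt_mul_iff_div_lt (hpos i)).1 (hi.trans (hk i hi0))
        obtain ⟨j, hj⟩ := Ordinal.lt_omega0.1 (h1.trans (Ordinal.natCast_lt_omega0 _))
        rw [hj, Nat.cast_lt] at h1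
        exact Set.mem_iUnion.2 ⟨⟨⟨i, hi0⟩, ⟨j, h1⟩⟩, hx, hj⟩

end Order

/-! ### Boxes and histories of minimal values -/

section Box

variable {P : Type u} [PartialOrder P] {ι C D : Type}

/-- With respect to the coordinate maps `π`, the set `X` is a product on which the order only
depends on the colours (given by `δ`) of the pairs of coordinates. -/
structure IsBox (X : Set P) (π : ι → P → C) (δ : C → C → D) : Prop where
  order : ∀ x ∈ X, ∀ y ∈ X, ∀ x' ∈ X, ∀ y' ∈ X,
    (∀ i, δ (π i x) (π i y) = δ (π i x') (π i y')) → x ≤ y → x' ≤ y'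
  mix : ∀ x ∈ X, ∀ y ∈ X, ∀ i, ∃ z ∈ X, π i z = π i y ∧ ∀ j, j ≠ i → π j z = π j x
  diag : ∀ x ∈ X, ∀ y ∈ X, ∀ i, δ (π i x) (π i x) = δ (π i y) (π i y)

/-- The order induced on the `i`-th coordinate by fixing all other coordinates. -/
def SliceLE (X : Set P) (π : ι → P → C) (i : ι) (a b : C) : Prop :=
  ∃ x ∈ X, ∃ y ∈ X, π i x = a ∧ π i y = b ∧ (∀ j, j ≠ i → π j x = π j y) ∧ x ≤ y

namespace IsBox

variable {X : Set P} {π : ι → P → C} {δ : C → C → D} {i : ι} {a b c : C} {x y z : P}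

theorem le_of_slice (hX : IsBox X π δ) (hx : x ∈ X) (hy : y ∈ X)
    (hxy : ∀ j, j ≠ i → π j x = π j y) (h : SliceLE X π i (π i x) (π i y)) : x ≤ y := by
  obtain ⟨x₀, hx₀, y₀, hy₀, hxi, hyi, hj, hle⟩ := h
  refine hX.order x₀ hx₀ y₀ hy₀ x hx y hy (fun j => ?_) hle
  rcases eq_or_ne j i with rfl | h
  · rw [hxi, hyi]
  · rw [← hj j h, ← hxy j h]
    exact hX.diag x₀ hx₀ x hx j

theorem le_of_coordinates_eq (hX : IsBox X π δ) (hx : x ∈ X) (hy : y ∈ X)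
    (h : ∀ j, π j x = π j y) : x ≤ y :=
  hX.order x hx x hx x hx y hy (fun j => by rw [h j]) le_rfl

theorem eq_of_coordinates_eq (hX : IsBox X π δ) (hx : x ∈ X) (hy : y ∈ X)
    (h : ∀ j, π j x = π j y) : x = y :=
  (hX.le_of_coordinates_eq hx hy h).antisymm (hX.le_of_coordinates_eq hy hx fun j => (h j).symm)

/-- Move from `x` to `y` by changing one coordinate at a time; each change is a step up in its
slice. -/
theorem le_of_forall_slice [Fintype ι] (hX : IsBox X π δ) (hx : x ∈ X) (hy : y ∈ X)
    (h : ∀ i, SliceLE X π i (π i x) (π i y)) : x ≤ y := by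
  classical
  have key : ∀ s : Finset ι, ∃ z ∈ X, (∀ i ∈ s, π i z = π i y) ∧ (∀ i ∉ s, π i z = π i x) ∧
      x ≤ z := by
    intro s
    induction s using Finset.induction_on with
    | empty => exact ⟨x, hx, by simp, fun _ _ => rfl, le_rfl⟩
    | insert i s hi ih =>
      obtain ⟨z, hz, hzy, hzx, hle⟩ := ih
      obtain ⟨w, hw, hwi, hwj⟩ := hX.mix z hz y hy i
      refine ⟨w, hw, fun j hj => ?_, fun j hj => ?_, hle.trans ?_⟩
      · rcases eq_or_ne j i with rfl | hji
        · exact hwi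
        · rw [hwj j hji, hzy j ((Finset.mem_insert.1 hj).resolve_left hji)]
      · rw [Finset.mem_insert, not_or] at hj
        rw [hwj j hj.1, hzx j hj.2]
      · refine hX.le_of_slice (i := i) hz hw (fun j hj => (hwj j hj).symm) ?_
        rw [hwi, hzx i hi]
        exact h i
  obtain ⟨z, hz, hzy, -, hle⟩ := key Finset.univ
  exact hle.trans (hX.le_of_coordinates_eq hz hy fun j => hzy j (Finset.mem_univ _))

theorem slice_refl (hx : x ∈ X) : SliceLE X π i (π i x) (π i x) :=
  ⟨x, hx, x, hx, rfl, rfl, fun _ _ => rfl, le_rfl⟩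

theorem exists_le_of_slice (hX : IsBox X π δ) (hx : x ∈ X) (h : SliceLE X π i (π i x) b) :
    ∃ y ∈ X, π i y = b ∧ (∀ j, j ≠ i → π j x = π j y) ∧ x ≤ y := by
  obtain ⟨-, -, z, hz, -, rfl, -, -⟩ := id h
  obtain ⟨y, hy, hyi, hyj⟩ := hX.mix x hx z hz i
  have hxy : ∀ j, j ≠ i → π j x = π j y := fun j hj => (hyj j hj).symm
  exact ⟨y, hy, hyi, hxy, hX.le_of_slice hx hy hxy (hyi ▸ h)⟩

theorem slice_comparable (hX : IsBox X π δ)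
    (hP : ∀ x y z : P, x ≤ y → x ≤ z → y ≤ z ∨ z ≤ y)
    (hab : SliceLE X π i a b) (hac : SliceLE X π i a c) :
    SliceLE X π i b c ∨ SliceLE X π i c b := by
  obtain ⟨x, hx, -, -, rfl, -, -, -⟩ := id hab
  obtain ⟨y, hy, rfl, hxy, hle⟩ := hX.exists_le_of_slice hx hab
  obtain ⟨z, hz, rfl, hxz, hle'⟩ := hX.exists_le_of_slice hx hac
  have hj : ∀ j, j ≠ i → π j y = π j z := fun j h => (hxy j h).symm.trans (hxz j h)
  rcases hP x y z hle hle' with h | h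
  · exact Or.inl ⟨y, hy, z, hz, rfl, rfl, hj, h⟩
  · exact Or.inr ⟨z, hz, y, hy, rfl, rfl, fun j h => (hj j h).symm, h⟩

/-- Put the `i`-th coordinate of `z` into `y`. The colours relative to `x` are unchanged, so the
result is also above `x` and therefore comparable with `y`. -/
theorem slice_comparable_of_color (hX : IsBox X π δ)
    (hP : ∀ x y z : P, x ≤ y → x ≤ z → y ≤ z ∨ z ≤ y)
    (hx : x ∈ X) (hy : y ∈ X) (hz : z ∈ X) (hxy : x ≤ y)
    (h : δ (π i x) (π i y) = δ (π i x) (π i z)) :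
    SliceLE X π i (π i y) (π i z) ∨ SliceLE X π i (π i z) (π i y) := by
  obtain ⟨w, hw, hwi, hwj⟩ := hX.mix y hy z hz i
  have hxw : x ≤ w := by
    refine hX.order x hx y hy x hx w hw (fun j => ?_) hxy
    rcases eq_or_ne j i with rfl | hj
    · rw [h, hwi]
    · rw [hwj j hj]
  rw [← hwi]
  rcases hP x y w hxy hxw with h | h
  · exact Or.inl ⟨y, hy, w, hw, rfl, rfl, fun j hj => (hwj j hj).symm, h⟩
  · exact Or.inr ⟨w, hw, y, hy, rfl, rfl, hwj, h⟩

/-- The set `B` of values in the `i`-th coordinate is a possible set of minimal values seen along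
a descending sequence that ends in `x`. -/
structure History (X : Set P) (π : ι → P → C) (i : ι) (x : P) (B : Finset C) : Prop where
  above : ∀ a ∈ B, ∃ y ∈ X, x ≤ y ∧ π i y = a
  antichain : ∀ a ∈ B, ∀ b ∈ B, SliceLE X π i a b → a = b
  covers : ∃ a ∈ B, SliceLE X π i a (π i x)

/-- Two values of the same colour relative to `π i x` would be comparable, so colour is injective on
the antichain. -/
theorem History.card_le [Finite D] (hX : IsBox X π δ)
    (hP : ∀ x y z : P, x ≤ y → x ≤ z → y ≤ z ∨ z ≤ y) (hx : x ∈ X) {B : Finset C}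
    (hB : History X π i x B) : B.card ≤ Nat.card D := by
  have := Fintype.ofFinite D
  rw [Nat.card_eq_fintype_card, ← Finset.card_univ]
  refine Finset.card_le_card_of_injOn (δ (π i x)) (fun _ _ => Finset.mem_coe.2 (Finset.mem_univ _))
    fun a ha b hb hab => ?_
  obtain ⟨y, hy, hxy, rfl⟩ := hB.above a ha
  obtain ⟨z, hz, hxz, rfl⟩ := hB.above b hb
  rcases hX.slice_comparable_of_color hP hx hy hz hxy hab with h | h
  · exact hB.antichain _ ha _ hb h
  · exact (hB.antichain _ hb _ ha h).symm

/-- The ordinal measure of a set of minimal values. -/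
noncomputable def measure (N : ℕ) (α : Ordinal.{u}) (h : C → Ordinal.{u}) (B : Finset C) :
    NatOrd.{u} :=
  ∑ a ∈ B, NatOrd.of (h a) + (N - B.card) • NatOrd.of α

theorem measure_le {N : ℕ} {α : Ordinal.{u}} {h : C → Ordinal.{u}} {B : Finset C}
    (hB : B.card ≤ N) (hh : ∀ a ∈ B, h a ≤ α) : measure N α h B ≤ N • NatOrd.of α := by
  calc measure N α h B ≤ B.card • NatOrd.of α + (N - B.card) • NatOrd.of α :=
        add_le_add_left (Finset.sum_le_card_nsmul _ _ _ fun a ha => NatOrd.of_le_of.2 (hh a ha)) _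
    _ = N • NatOrd.of α := by rw [← add_nsmul, Nat.add_sub_cancel' hB]

/-- If the new value lies above a recorded one, nothing changes. If it lies strictly below a
recorded one, it replaces that one, which is unique by comparability, and the height drops.
Otherwise it is added, and one of the reserved summands `α` is traded for a height below `α`; the
cardinality bound guarantees that a reserve is left. -/
theorem History.step [Finite D] (hX : IsBox X π δ)
    (hP : ∀ x y z : P, x ≤ y → x ≤ z → y ≤ z ∨ z ≤ y) {α : Ordinal.{u}} {h : C → Ordinal.{u}}
    (hmono : ∀ a b, SliceLE X π i a b → a ≠ b → h a < h b) (hα : ∀ x ∈ X, h (π i x) < α)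
    (hy : y ∈ X) (hyx : y ≤ x) {B : Finset C}
    (hB : History X π i x B) :
    ∃ B', History X π i y B' ∧
      (B' = B ∨ measure (Nat.card D) α h B' < measure (Nat.card D) α h B) := by
  classical
  have habove : ∀ a ∈ B, ∃ z ∈ X, y ≤ z ∧ π i z = a := fun a ha => by
    obtain ⟨z, hz, hxz, hza⟩ := hB.above a ha
    exact ⟨z, hz, hyx.trans hxz, hza⟩
  by_cases h1 : ∃ a ∈ B, SliceLE X π i a (π i y)
  · exact ⟨B, ⟨habove, hB.antichain, h1⟩, Or.inl rfl⟩
  push Not at h1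
  have hyB : π i y ∉ B := fun hmem => h1 _ hmem (slice_refl hy)
  by_cases h2 : ∃ a ∈ B, SliceLE X π i (π i y) a
  · obtain ⟨a, ha, hya⟩ := h2
    have hne : π i y ≠ a := fun h => hyB (h ▸ ha)
    have hyB' : π i y ∉ B.erase a := fun hmem => hyB (Finset.mem_of_mem_erase hmem)
    have hcard : (insert (π i y) (B.erase a)).card = B.card := by
      rw [Finset.card_insert_of_notMem hyB', Finset.card_erase_add_one ha]
    have hup : ∀ b ∈ B.erase a, ¬ SliceLE X π i (π i y) b := by
      intro b hb hyb
      have hb' := Finset.mem_erase.1 hb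
      rcases hX.slice_comparable hP hya hyb with h | h
      · exact hb'.1 (hB.antichain _ ha _ hb'.2 h).symm
      · exact hb'.1 (hB.antichain _ hb'.2 _ ha h)
    refine ⟨insert (π i y) (B.erase a), ⟨?_, ?_, ?_⟩, Or.inr ?_⟩
    · intro b hb
      rcases Finset.mem_insert.1 hb with rfl | hb
      · exact ⟨y, hy, le_rfl, rfl⟩
      · exact habove b (Finset.mem_of_mem_erase hb)
    · intro b hb c hc hbc
      rcases Finset.mem_insert.1 hb with rfl | hb <;> rcases Finset.mem_insert.1 hc with rfl | hc
      · rfl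
      · exact absurd hbc (hup c hc)
      · exact absurd hbc (h1 b (Finset.mem_of_mem_erase hb))
      · exact hB.antichain _ (Finset.mem_of_mem_erase hb) _ (Finset.mem_of_mem_erase hc) hbc
    · exact ⟨_, Finset.mem_insert_self _ _, slice_refl hy⟩
    · rw [measure, measure, hcard, Finset.sum_insert hyB', ← Finset.add_sum_erase _ _ ha]
      exact add_lt_add_left (add_lt_add_left (NatOrd.of_lt_of.2 (hmono _ _ hya hne)) _) _
  · push Not at h2
    have hB' : History X π i y (insert (π i y) B) := by
      refine ⟨?_, ?_, ?_⟩
      · intro b hb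
        rcases Finset.mem_insert.1 hb with rfl | hb
        · exact ⟨y, hy, le_rfl, rfl⟩
        · exact habove b hb
      · intro b hb c hc hbc
        rcases Finset.mem_insert.1 hb with rfl | hb <;> rcases Finset.mem_insert.1 hc with rfl | hc
        · rfl
        · exact absurd hbc (h2 c hc)
        · exact absurd hbc (h1 b hb)
        · exact hB.antichain _ hb _ hc hbc
      · exact ⟨_, Finset.mem_insert_self _ _, slice_refl hy⟩
    refine ⟨_, hB', Or.inr ?_⟩
    have hcard := hB'.card_le hX hP hy
    rw [Finset.card_insert_of_notMem hyB] at hcard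
    obtain ⟨k, hk⟩ := Nat.exists_eq_add_of_le hcard
    rw [measure, measure, Finset.card_insert_of_notMem hyB, Finset.sum_insert hyB,
      show Nat.card D - (B.card + 1) = k by omega, show Nat.card D - B.card = k + 1 by omega,
      succ_nsmul, add_comm (NatOrd.of (h (π i y))), add_assoc]
    refine add_lt_add_right ?_ _
    rw [add_comm]
    exact add_lt_add_right (NatOrd.of_lt_of.2 (hα y hy)) _

/-- The elements of `X` all of whose coordinates lie above the given finite sets of values. -/
def region (X : Set P) (π : ι → P → C) (A : ι → Finset C) : Set P :=
  {x ∈ X | ∀ i, ∃ a ∈ A i, SliceLE X π i a (π i x)}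

/-- The rank of `x` with histories `A` is at most `R * μ A + r A x`. A step down with unchanged
histories lowers `r A`; any change of histories lowers `μ`, and the gained factor `R` absorbs the
new value of `r`. -/
theorem rankLE [WellFoundedLT P] [Fintype ι] [Finite D] (hX : IsBox X π δ)
    (hP : ∀ x y z : P, x ≤ y → x ≤ z → y ≤ z ∨ z ≤ y) {α R : Ordinal.{u}}
    {h : ι → C → Ordinal.{u}}
    (hmono : ∀ i a b, SliceLE X π i a b → a ≠ b → h i a < h i b)
    (hα : ∀ i, ∀ x ∈ X, h i (π i x) < α)
    (hR : ∀ A : ι → Finset C, RankLE (· < ·) (region X π A) R) :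
    RankLE (· < ·) X
      (R * succ (∑ _i : ι, Nat.card D • NatOrd.of α).ord) := by
  classical
  choose r hr hrR using hR
  let μ : (ι → Finset C) → NatOrd.{u} := fun A => ∑ i, measure (Nat.card D) α (h i) (A i)
  have key : ∀ x : P, ∀ A : ι → Finset C, x ∈ X → (∀ i, History X π i x (A i)) →
      IsWellFounded.rank (ltOn X) x ≤ R * (μ A).ord + r A x := by
    intro x
    induction x using WellFoundedLT.induction with
    | ind x ih =>
      intro A hx hA
      rw [IsWellFounded.rank_eq]
      refine Ordinal.iSup_le fun ⟨y, hy, hyx⟩ => succ_le_of_lt ?_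
      choose A' hA' hAA' using fun i => (hA i).step hX hP (hmono i) (hα i) hy hyx.le
      refine (ih y hyx A' hy hA').trans_lt ?_
      by_cases heq : A' = A
      · subst heq
        gcongr
        exact hr A' y ⟨hy, fun i => (hA' i).covers⟩ x ⟨hx, fun i => (hA i).covers⟩ hyx
      · obtain ⟨i₀, hi₀⟩ := Function.ne_iff.1 heq
        have hμ : μ A' < μ A := by
          refine Finset.sum_lt_sum (fun i _ => ?_)
            ⟨i₀, Finset.mem_univ _, (hAA' i₀).resolve_left hi₀⟩
          rcases hAA' i with h | h
          · rw [h]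
          · exact h.le
        calc R * (μ A').ord + r A' y < R * (μ A').ord + R := by
              gcongr
              exact hrR A' y ⟨hy, fun i => (hA' i).covers⟩
          _ = R * succ (μ A').ord := (Ordinal.mul_succ _ _).symm
          _ ≤ R * (μ A).ord := by
              gcongr
              exact succ_le_of_lt hμ
          _ ≤ _ := le_self_add
  refine rankLE_of_rank_lt fun x hx => ?_
  have hA : ∀ i, History X π i x {π i x} := fun i => by
    refine ⟨fun a ha => ⟨x, hx, le_rfl, (Finset.mem_singleton.1 ha).symm⟩, fun a ha b hb _ => ?_,
      _, Finset.mem_singleton_self _, slice_refl hx⟩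
    rw [Finset.mem_singleton.1 ha, Finset.mem_singleton.1 hb]
  have hμ : μ (fun i => {π i x}) ≤ ∑ _i : ι, Nat.card D • NatOrd.of α := by
    refine Finset.sum_le_sum fun i _ => measure_le ((hA i).card_le hX hP hx) fun a ha => ?_
    rw [Finset.mem_singleton.1 ha]
    exact (hα i x hx).le
  calc IsWellFounded.rank (ltOn X) x
      ≤ R * (μ fun i => {π i x}).ord + r (fun i => {π i x}) x := key x _ hx hA
    _ < R * (μ fun i => {π i x}).ord + R := by
        gcongr
        exact hrR _ x ⟨hx, fun i => (hA i).covers⟩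
    _ = R * succ (μ fun i => {π i x}).ord := (Ordinal.mul_succ _ _).symm
    _ ≤ _ := by
        gcongr
        exact hμ

/-- Choose in each coordinate one value of `A i` that lies below. The values above it form a chain,
so if no height increased from `x` to `y`, every coordinate of `y` would be below that of `x`,
giving `y ≤ x`. Thus `rankLE_of_coordinates` applies to each of the finitely many choices. -/
theorem rankLE_region [WellFoundedLT P] [Fintype ι] (hX : IsBox X π δ)
    (hP : ∀ x y z : P, x ≤ y → x ≤ z → y ≤ z ∨ z ≤ y) {ε : Ordinal.{u}}
    {h : ι → C → Ordinal.{u}}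
    (hmono : ∀ i a b, SliceLE X π i a b → a ≠ b → h i a < h i b)
    (hε : ∀ i, ∀ x ∈ X, h i (π i x) < ω ^ ε) (A : ι → Finset C) :
    RankLE (· < ·) (region X π A) (ω ^ succ (∑ _i : ι, NatOrd.of ε).ord) := by
  classical
  suffices h : ∃ α < ω ^ succ (∑ _i : ι, NatOrd.of ε).ord, RankLE (· < ·) (region X π A) α by
    obtain ⟨α, hα, hr⟩ := h
    exact hr.mono hα.le
  refine rankLE_iUnion (ι := Fintype.piFinset A)
    (S := fun φ => {x ∈ X | ∀ i, SliceLE X π i (φ.1 i) (π i x)})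
    (zero_le.trans_lt (lt_succ _)).ne' ?_ ?_
  · rintro ⟨φ, hφ⟩
    refine ⟨_, (Ordinal.opow_lt_opow_iff_right Ordinal.one_lt_omega0).2 (lt_succ _),
      rankLE_of_coordinates _ (fun _ => ε) _ (fun i x => h i (π i x)) rfl ?_
        fun i x hx => hε i x hx.1⟩
    rintro x ⟨hx, hφx⟩ y ⟨hy, hφy⟩ hxy
    by_contra! hcon
    refine hxy.not_ge (hX.le_of_forall_slice hy hx fun i => ?_)
    rcases hX.slice_comparable hP (hφx i) (hφy i) with hs | hs
    · rcases eq_or_ne (π i x) (π i y) with he | he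
      · rw [he]
        exact slice_refl hy
      · exact absurd (hmono i _ _ hs he) (not_lt.2 (hcon i))
    · exact hs
  · rintro x ⟨hx, hA⟩
    choose φ hφA hφ using hA
    exact Set.mem_iUnion.2 ⟨⟨φ, Fintype.mem_piFinset.2 hφA⟩, hx, hφ⟩

/-- An up-set in a slice is the image of an up-set in `P`, and an element of a box is determined by
its coordinates. -/
theorem region_finite [Fintype ι] (hX : IsBox X π δ) (hP : ∀ x : P, (Set.Ici x).Finite)
    (A : ι → Finset C) : (region X π A).Finite := by
  have hslice : ∀ i a, {b | SliceLE X π i a b}.Finite := by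
    intro i a
    rcases Set.eq_empty_or_nonempty {b | SliceLE X π i a b} with h | ⟨b, hb⟩
    · rw [h]
      exact Set.finite_empty
    · obtain ⟨x, hx, -, -, rfl, -, -, -⟩ := hb
      refine ((hP x).image (π i)).subset fun b hb => ?_
      obtain ⟨y, -, hyb, -, hxy⟩ := hX.exists_le_of_slice hx hb
      exact ⟨y, hxy, hyb⟩
  have hfin : (Set.univ.pi fun i => ⋃ a ∈ A i, {b | SliceLE X π i a b}).Finite :=
    Set.Finite.pi fun i => (A i).finite_toSet.biUnion fun a _ => hslice i a
  refine Set.Finite.of_finite_image (f := fun x i => π i x) (hfin.subset ?_) ?_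
  · rintro _ ⟨x, hx, rfl⟩ i -
    obtain ⟨a, ha, h⟩ := hx.2 i
    exact Set.mem_biUnion ha h
  · intro x hx y hy hxy
    exact hX.eq_of_coordinates_eq hx.1 hy.1 fun i => congrFun hxy i

end IsBox

end Box

/-! ### Cutting and gluing runs -/

section Runs

variable {B Q : Type}

/-- The part of a partial labeling below the word `u`. -/
def sub (u : List Bool) (c : List Bool → Option B) : List Bool → Option B := fun w => c (u ++ w)

/-- `ρ` is a run on the (possibly empty) partial labeling `c`, with no condition on the state at
the root. -/
structure IsRun (M : TreeAutomaton B Q) (c : List Bool → Option B) (ρ : List Bool → Q) :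
    Prop where
  step : ∀ w a, c w = some a → (ρ w, a, ρ (w ++ [false]), ρ (w ++ [true])) ∈ M.trans
  final : ∀ w, c w = none → (∀ v b, w = v ++ [b] → c v ≠ none) → ρ w ∈ M.final

/-- The states from which there is a run on `c`. -/
def accStates (M : TreeAutomaton B Q) (c : List Bool → Option B) : Set Q :=
  {q | ∃ ρ, IsRun M c ρ ∧ ρ [] = q}

/-- The words outside `T` all of whose proper prefixes are in the prefix-closed set `T`. -/
def FrontierOf (T : Set (List Bool)) (s : List Bool) : Prop :=
  s ∉ T ∧ ∃ u ∈ T, ∃ b : Bool, s = u ++ [b]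

theorem exists_frontier_prefix {T : Set (List Bool)} (h0 : [] ∈ T) (w : List Bool) (hw : w ∉ T) :
    ∃ s v, FrontierOf T s ∧ w = s ++ v := by
  induction w using List.reverseRecOn with
  | nil => exact absurd h0 hw
  | append_singleton w b ih =>
    by_cases h : w ∈ T
    · exact ⟨w ++ [b], [], ⟨hw, w, h, b, rfl⟩, (List.append_nil _).symm⟩
    · obtain ⟨s, v, hs, rfl⟩ := ih h
      exact ⟨s, v ++ [b], hs, List.append_assoc _ _ _⟩

theorem FrontierOf.eq_of_prefix {T : Set (List Bool)} (hT : ∀ v w, v <+: w → w ∈ T → v ∈ T)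
    {s s' : List Bool} (hs : FrontierOf T s) (hs' : FrontierOf T s') (h : s <+: s') : s = s' := by
  obtain ⟨-, u, hu, b, rfl⟩ := hs'
  rcases List.prefix_concat_iff.1 h with h | h
  · exact h
  · exact absurd (hT _ _ h hu) hs.1

theorem FrontierOf.eq_of_append {T : Set (List Bool)} (hT : ∀ v w, v <+: w → w ∈ T → v ∈ T)
    {s s' v v' : List Bool} (hs : FrontierOf T s) (hs' : FrontierOf T s')
    (h : s ++ v = s' ++ v') : s = s' := by
  rcases List.prefix_or_prefix_of_prefix (List.prefix_append s v) (h ▸ List.prefix_append s' v')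
    with h | h
  · exact hs.eq_of_prefix hT hs' h
  · exact (hs'.eq_of_prefix hT hs h).symm

theorem IsRun.sub {M : TreeAutomaton B Q} {c : List Bool → Option B} {ρ : List Bool → Q}
    (h : IsRun M c ρ) {u : List Bool} {b : Bool} (hu : c u ≠ none) :
    IsRun M (sub (u ++ [b]) c) fun w => ρ (u ++ [b] ++ w) := by
  refine ⟨fun w a hw => ?_, fun w hw hp => h.final _ hw fun v b' hv => ?_⟩
  · simpa only [List.append_assoc] using h.step (u ++ [b] ++ w) a hw
  · rcases List.eq_nil_or_concat' w with rfl | ⟨w', b'', rfl⟩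
    · rw [List.append_nil] at hv
      rwa [← (List.append_inj' hv rfl).1]
    · rw [← List.append_assoc] at hv
      rw [← (List.append_inj' hv rfl).1]
      exact hp w' b'' rfl

/-- Keep the run on `T` and, at each frontier word, continue with a run on the new part that starts
in the same state. Every word outside `T` has a unique frontier prefix, so the glued run is well
defined. -/
theorem accStates_subset_of_defined (M : TreeAutomaton B Q) {T : Set (List Bool)}
    (hT : ∀ v w, v <+: w → w ∈ T → v ∈ T) (h0 : [] ∈ T) {c c' : List Bool → Option B}
    (hcc : ∀ w ∈ T, c w = c' w) (hdef : ∀ w ∈ T, c w ≠ none)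
    (hfr : ∀ s, FrontierOf T s → accStates M (sub s c) ⊆ accStates M (sub s c')) :
    accStates M c ⊆ accStates M c' := by
  classical
  rintro _ ⟨ρ, hρ, rfl⟩
  have hσ : ∀ s, ∃ σ : List Bool → Q, FrontierOf T s → IsRun M (sub s c') σ ∧ σ [] = ρ s := by
    intro s
    by_cases hs : FrontierOf T s
    · have hmem : ρ s ∈ accStates M (sub s c) := by
        obtain ⟨-, u, hu, b, rfl⟩ := hs
        exact ⟨_, hρ.sub (hdef u hu), by rw [List.append_nil]⟩
      obtain ⟨σ, h⟩ := hfr s hs hmem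
      exact ⟨σ, fun _ => h⟩
    · exact ⟨ρ, fun h => absurd h hs⟩
  choose σ hσ using hσ
  have hex : ∀ w, ∃ q, (w ∈ T → q = ρ w) ∧
      ∀ s v, FrontierOf T s → w = s ++ v → q = σ s v := by
    intro w
    by_cases hw : w ∈ T
    · refine ⟨ρ w, fun _ => rfl, fun s v hs hsv => ?_⟩
      exact absurd (hT s w (hsv ▸ List.prefix_append s v) hw) hs.1
    · obtain ⟨s, v, hs, rfl⟩ := exists_frontier_prefix h0 w hw
      refine ⟨σ s v, fun h => absurd h hw, fun s' v' hs' h => ?_⟩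
      obtain rfl := hs.eq_of_append hT hs' h
      rw [List.append_cancel_left h]
  choose ρ' hρT hρF using hex
  have hchild : ∀ w ∈ T, ∀ b : Bool, ρ' (w ++ [b]) = ρ (w ++ [b]) := by
    intro w hw b
    by_cases hb : w ++ [b] ∈ T
    · exact hρT _ hb
    · have hs : FrontierOf T (w ++ [b]) := ⟨hb, w, hw, b, rfl⟩
      rw [hρF _ (w ++ [b]) [] hs (List.append_nil _).symm, (hσ _ hs).2]
  refine ⟨ρ', ⟨fun w a hw => ?_, fun w hw hp => ?_⟩, hρT [] h0⟩
  · by_cases hwT : w ∈ T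
    · rw [hρT w hwT, hchild w hwT, hchild w hwT]
      exact hρ.step w a ((hcc w hwT).trans hw)
    · obtain ⟨s, v, hs, rfl⟩ := exists_frontier_prefix h0 w hwT
      rw [hρF _ s v hs rfl, hρF _ s (v ++ [false]) hs (List.append_assoc _ _ _),
        hρF _ s (v ++ [true]) hs (List.append_assoc _ _ _)]
      exact (hσ s hs).1.step v a hw
  · by_cases hwT : w ∈ T
    · exact absurd ((hcc w hwT).trans hw) (hdef w hwT)
    · obtain ⟨s, v, hs, rfl⟩ := exists_frontier_prefix h0 w hwT
      rw [hρF _ s v hs rfl]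
      refine (hσ s hs).1.final v hw fun v' b hv => ?_
      exact hp (s ++ v') b (by rw [hv, List.append_assoc])

/-- The domain of the partial labeling `c` is prefix-closed. -/
def PrefixClosed (c : List Bool → Option B) : Prop :=
  ∀ v w : List Bool, v <+: w → c w ≠ none → c v ≠ none

theorem PrefixClosed.sub_eq_none {c : List Bool → Option B} (hc : PrefixClosed c)
    {u v : List Bool} (huv : u <+: v) (hu : c u = none) : sub v c = fun _ => none := by
  funext w
  by_contra h
  exact hc u _ (huv.trans (List.prefix_append v w)) h hu

/-- Apply the gluing to the words of `T` where `c` is defined. A new frontier word inside `T`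
carries the empty labeling on both sides. -/
theorem accStates_subset (M : TreeAutomaton B Q) {T : Set (List Bool)}
    (hT : ∀ v w, v <+: w → w ∈ T → v ∈ T) (h0 : [] ∈ T) {c c' : List Bool → Option B}
    (hc : PrefixClosed c) (hc' : PrefixClosed c') (hroot : c [] ≠ none)
    (hcc : ∀ w ∈ T, c w = c' w)
    (hfr : ∀ s, FrontierOf T s → accStates M (sub s c) = accStates M (sub s c')) :
    accStates M c ⊆ accStates M c' := by
  refine accStates_subset_of_defined M (T := {w ∈ T | c w ≠ none})
    (fun v w hvw hw => ⟨hT v w hvw hw.1, hc v w hvw hw.2⟩) ⟨h0, hroot⟩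
    (fun w hw => hcc w hw.1) (fun w hw => hw.2) ?_
  rintro s ⟨hs, u, hu, b, hsu⟩
  by_cases hsT : s ∈ T
  · have hcs : c s = none := by
      by_contra h
      exact hs ⟨hsT, h⟩
    rw [hc.sub_eq_none (List.prefix_refl s) hcs,
      hc'.sub_eq_none (List.prefix_refl s) ((hcc s hsT).symm.trans hcs)]
  · exact (hfr s ⟨hsT, u, hu.1, b, hsu⟩).subset

end Runs

/-! ### Convolutions and colours of pairs -/

section Pairs

variable {A Q : Type}

open Classical in
/-- The labeling of the convolution of two partial labelings. -/
noncomputable def pairLabel (x y : List Bool → Option A) : List Bool → Option (Fin 2 → Option A) :=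
  fun w => if x w ≠ none ∨ y w ≠ none then some ![x w, y w] else none

theorem pairLabel_ne_none {x y : List Bool → Option A} {w : List Bool} :
    pairLabel x y w ≠ none ↔ x w ≠ none ∨ y w ≠ none := by
  unfold pairLabel
  split_ifs with h
  · simpa using h
  · simpa using h

theorem pairLabel_congr {x y x' y' : List Bool → Option A} {w : List Bool} (hx : x w = x' w)
    (hy : y w = y' w) : pairLabel x y w = pairLabel x' y' w := by
  unfold pairLabel
  rw [hx, hy]

theorem pairLabel_bind_zero (x y : List Bool → Option A) (w : List Bool) :
    ((pairLabel x y w).bind fun a => a 0) = x w := by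
  unfold pairLabel
  split_ifs with h
  · simp
  · push Not at h
    simp [h.1]

theorem pairLabel_bind_one (x y : List Bool → Option A) (w : List Bool) :
    ((pairLabel x y w).bind fun a => a 1) = y w := by
  unfold pairLabel
  split_ifs with h
  · simp
  · push Not at h
    simp [h.2]

theorem PrefixClosed.pairLabel {x y : List Bool → Option A} (hx : PrefixClosed x)
    (hy : PrefixClosed y) : PrefixClosed (pairLabel x y) := by
  intro v w hvw hw
  exact pairLabel_ne_none.2 ((pairLabel_ne_none.1 hw).imp (hx v w hvw) (hy v w hvw))

theorem convolution_label (s t : LabeledTree A) :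
    (LabeledTree.convolution ![s, t]).label = pairLabel s.label t.label := by
  funext w
  unfold pairLabel
  simp only [LabeledTree.convolution, LabeledTree.nodes, Fin.exists_fin_two, Set.mem_ofPred_eq,
    Matrix.cons_val_zero, Matrix.cons_val_one]
  have : (fun i => (![s, t] i).label w) = ![s.label w, t.label w] := by
    funext i
    fin_cases i <;> rfl
  rw [this]

theorem convolution_pair_inj {s t s' t' : LabeledTree A}
    (h : LabeledTree.convolution ![s, t] = LabeledTree.convolution ![s', t']) :
    s = s' ∧ t = t' := by
  have h' : pairLabel s.label t.label = pairLabel s'.label t'.label := by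
    rw [← convolution_label, h, convolution_label]
  constructor
  · ext1
    funext w
    rw [← pairLabel_bind_zero s.label t.label, h', pairLabel_bind_zero]
  · ext1
    funext w
    rw [← pairLabel_bind_one s.label t.label, h', pairLabel_bind_one]

/-- The colour of a pair of partial labelings: the states that accept their convolution. -/
def color (M : TreeAutomaton (Fin 2 → Option A) Q) (x y : List Bool → Option A) : Set Q :=
  accStates M (pairLabel x y)

theorem mem_language_iff {B : Type} (M : TreeAutomaton B Q) (t : LabeledTree B) :
    t ∈ M.language ↔ (accStates M t.label ∩ M.init).Nonempty := by
  constructor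
  · rintro ⟨ρ, h⟩
    refine ⟨ρ [], ⟨ρ, ⟨h.step, fun w hw hp => ?_⟩, rfl⟩, h.root⟩
    rcases List.eq_nil_or_concat' w with rfl | ⟨v, b, rfl⟩
    · exact absurd hw t.root_mem
    · exact h.frontier _ ⟨⟨v, hp v b rfl, b, rfl⟩, fun hmem => hmem hw⟩
  · rintro ⟨_, ⟨ρ, h, rfl⟩, hinit⟩
    refine ⟨ρ, hinit, ?_, h.step⟩
    rintro w ⟨⟨v, hv, b, rfl⟩, hw⟩
    refine h.final _ (not_not.1 hw) fun v' b' hv' => ?_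
    rw [← (List.append_inj' hv' rfl).1]
    exact hv

end Pairs

theorem LabeledTree.frontierOf_iff {A : Type} (t : LabeledTree A) (s : List Bool) :
    FrontierOf t.nodes s ↔ s ∈ t.frontier :=
  and_comm

theorem LabeledTree.finite_frontier {A : Type} (t : LabeledTree A) : t.frontier.Finite := by
  refine ((t.finite_nodes.prod (Set.finite_univ (α := Bool))).image
    fun q => q.1 ++ [q.2]).subset ?_
  rintro _ ⟨⟨v, hv, b, rfl⟩, -⟩
  exact ⟨(v, b), ⟨hv, trivial⟩, rfl⟩

/-! ### Decomposing a principal ideal into boxes -/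

section Pieces

variable {A Q : Type}

/-- The colours of a partial labeling that decide how it relates to the empty labeling and to
itself. -/
def colorType (M : TreeAutomaton (Fin 2 → Option A) Q) (x : List Bool → Option A) :
    Set Q × Set Q :=
  (color M x fun _ => none, color M x x)

/-- The finite prefix-closed partial labelings of a given colour type. -/
def component (M : TreeAutomaton (Fin 2 → Option A) Q) (τ : Set Q × Set Q) :
    Set (List Bool → Option A) :=
  {x | {w | x w ≠ none}.Finite ∧ PrefixClosed x ∧ colorType M x = τ}

/-- The relation on partial labelings given by a set of colours. -/
def colorLT (M : TreeAutomaton (Fin 2 → Option A) Q) (f : Set (Set Q))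
    (x y : List Bool → Option A) : Prop :=
  color M x y ∈ f ∧ x ≠ y

theorem sub_mem_component (M : TreeAutomaton (Fin 2 → Option A) Q) (t : LabeledTree A)
    (u : List Bool) : sub u t.label ∈ component M (colorType M (sub u t.label)) := by
  refine ⟨?_, fun v w hvw hw => ?_, rfl⟩
  · exact t.finite_nodes.preimage (f := fun w => u ++ w)
      fun v _ w _ h => List.append_cancel_left h
  · exact t.prefix_closed _ _ ((List.prefix_append_right_inj u).2 hvw) hw

/-- Replacing the part of a tree below a frontier word of the prefix-closed set `T`. -/
theorem exists_replace (t : LabeledTree A) {T : Set (List Bool)}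
    (hT : ∀ v w, v <+: w → w ∈ T → v ∈ T) (h0 : [] ∈ T) {u : List Bool} (hu : FrontierOf T u)
    {s : List Bool → Option A} (hfin : {w | s w ≠ none}.Finite) (hs : PrefixClosed s)
    (hparent : (s = fun _ => none) ∨ ∀ v b, u = v ++ [b] → t.label v ≠ none) :
    ∃ t' : LabeledTree A, (∀ w ∈ T, t'.label w = t.label w) ∧ sub u t'.label = s ∧
      ∀ v, FrontierOf T v → v ≠ u → sub v t'.label = sub v t.label := by
  classical
  let l : List Bool → Option A := fun w => if u <+: w then s (w.drop u.length) else t.label w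
  have hl : ∀ w, l (u ++ w) = s w := fun w => by
    simp only [l, if_pos (List.prefix_append u w), List.drop_left]
  have hl' : ∀ w, ¬ u <+: w → l w = t.label w := fun w hw => if_neg hw
  refine ⟨⟨l, ?_, ?_, ?_⟩, ?_, ?_, ?_⟩
  · refine ((hfin.image fun w => u ++ w).union t.finite_nodes).subset fun w hw => ?_
    by_cases h : u <+: w
    · obtain ⟨w, rfl⟩ := h
      exact Or.inl ⟨w, fun h => hw ((hl w).trans h), rfl⟩
    · exact Or.inr fun h' => hw ((hl' w h).trans h')
  · intro v w hvw hw
    by_cases hw' : u <+: w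
    · obtain ⟨w, rfl⟩ := hw'
      rw [hl] at hw
      by_cases hv : u <+: v
      · obtain ⟨v, rfl⟩ := hv
        rw [hl]
        exact hs v w ((List.prefix_append_right_inj u).1 hvw) hw
      · rw [hl' v hv]
        have hvu : v <+: u :=
          (List.prefix_or_prefix_of_prefix hvw (List.prefix_append u w)).resolve_right hv
        rcases hparent with h | h
        · rw [h] at hw
          exact absurd rfl hw
        · obtain ⟨-, p, -, b, rfl⟩ := hu
          rcases List.prefix_concat_iff.1 hvu with rfl | hvp
          · exact absurd (List.prefix_refl _) hv
          · exact t.prefix_closed v p hvp (h p b rfl)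
    · rw [hl' w hw'] at hw
      rw [hl' v fun h => hw' (h.trans hvw)]
      exact t.prefix_closed v w hvw hw
  · rw [hl' [] fun h => hu.1 (hT _ _ h h0)]
    exact t.root_mem
  · exact fun w hw => hl' w fun h => hu.1 (hT _ _ h hw)
  · exact funext hl
  · refine fun v hv hvu => funext fun w => hl' _ fun h => hvu ?_
    obtain ⟨w', hw'⟩ := h
    exact hv.eq_of_append hT hu hw'.symm

/-- The part of the tree of `x` below a frontier word of the tree of `p`. -/
def part {P : Type u} (e : P → LabeledTree A) (p : P) (i : (e p).frontier) (x : P) :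
    List Bool → Option A :=
  sub i (e x).label

theorem part_eq_none {P : Type u} {e : P → LabeledTree A} {p x : P}
    (i : (e p).frontier) {v : List Bool} {b : Bool}
    (hv : i.1 = v ++ [b]) (h : (e x).label v = none) : part e p i x = fun _ => none :=
  PrefixClosed.sub_eq_none (e x).prefix_closed (hv ▸ List.prefix_append v [b]) h

variable {P : Type u} [PartialOrder P]

/-- The automaton `M` recognizes the order of `P` through the encoding `e`. -/
structure Recognizes (M : TreeAutomaton (Fin 2 → Option A) Q) (e : P → LabeledTree A) : Prop where
  injective : Function.Injective e
  nonempty : ∀ p q, p ≤ q → (color M (e p).label (e q).label ∩ M.init).Nonempty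
  exists_le : ∀ s t : LabeledTree A, (color M s.label t.label ∩ M.init).Nonempty →
    ∃ p q, p ≤ q ∧ s = e p ∧ t = e q

theorem recognizes_of_language {M : TreeAutomaton (Fin 2 → Option A) Q} {e : P → LabeledTree A}
    (he : Function.Injective e)
    (hM : M.language = LabeledTree.convolution ''
      {t : Fin 2 → LabeledTree A | ∃ p q : P, p ≤ q ∧ t = ![e p, e q]}) : Recognizes M e := by
  refine ⟨he, fun p q hpq => ?_, fun s t hst => ?_⟩
  · have : LabeledTree.convolution ![e p, e q] ∈ M.language := by
      rw [hM]
      exact ⟨_, ⟨p, q, hpq, rfl⟩, rfl⟩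
    rwa [mem_language_iff, convolution_label] at this
  · have : LabeledTree.convolution ![s, t] ∈ M.language := by
      rwa [mem_language_iff, convolution_label]
    rw [hM] at this
    obtain ⟨_, ⟨p, q, hpq, rfl⟩, h⟩ := this
    obtain ⟨h1, h2⟩ := convolution_pair_inj h
    exact ⟨p, q, hpq, h1.symm, h2.symm⟩

namespace Recognizes

variable {M : TreeAutomaton (Fin 2 → Option A) Q} {e : P → LabeledTree A}

theorem le_of_color_subset (hM : Recognizes M e) {x y x' y' : P} (h : x ≤ y)
    (hc : color M (e x).label (e y).label ⊆ color M (e x').label (e y').label) : x' ≤ y' := by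
  obtain ⟨p, q, hpq, h1, h2⟩ := hM.exists_le _ _
    ((hM.nonempty x y h).mono (Set.inter_subset_inter_left _ hc))
  rwa [hM.injective h1, hM.injective h2]

variable (M e)

/-- The restriction of the tree of `x` to the nodes of the tree of `p`, together with the colour
types of its parts at the frontier of the tree of `p`. -/
def skeleton (p x : P) :
    ((e p).nodes → Option A) × ((e p).frontier → Set Q × Set Q) :=
  (fun w => (e x).label w, fun s => colorType M (sub s (e x).label))

/-- The elements below `p` with a given skeleton. -/
def piece (p : P) (k : ((e p).nodes → Option A) × ((e p).frontier → Set Q × Set Q)) : Set P :=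
  {x | x ≤ p ∧ skeleton M e p x = k}

variable {M e} {p : P} {k : ((e p).nodes → Option A) × ((e p).frontier → Set Q × Set Q)}

theorem piece_label_eq {x y : P} (hx : x ∈ piece M e p k) (hy : y ∈ piece M e p k)
    {w : List Bool} (hw : w ∈ (e p).nodes) : (e x).label w = (e y).label w :=
  congrFun (congrArg Prod.fst (hx.2.trans hy.2.symm)) ⟨w, hw⟩

theorem piece_colorType_eq {x y : P} (hx : x ∈ piece M e p k) (hy : y ∈ piece M e p k)
    (i : (e p).frontier) : colorType M (part e p i x) = colorType M (part e p i y) :=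
  congrFun (congrArg Prod.snd (hx.2.trans hy.2.symm)) i

/-- The tree of `p` is empty at its frontier, so acceptance against `p` sees the hanging parts only
through their colours relative to the empty labeling. The first entry of the colour type preserves
these, so the new tree again encodes an element below `p`. -/
theorem exists_replace (hM : Recognizes M e) {x : P} (hx : x ∈ piece M e p k)
    (i : (e p).frontier) {s : List Bool → Option A}
    (hs : s ∈ component M (colorType M (part e p i x)))
    (hparent : (s = fun _ => none) ∨ ∀ v b, i.1 = v ++ [b] → (e x).label v ≠ none) :
    ∃ z ∈ piece M e p k, part e p i z = s ∧ ∀ j, j ≠ i → part e p j z = part e p j x := by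
  have hi := ((e p).frontierOf_iff i).2 i.2
  obtain ⟨t, htT, hti, htj⟩ := TreeAutomatic.exists_replace (e x) (e p).prefix_closed
    (e p).root_mem hi hs.1 hs.2.1 hparent
  have htype : ∀ j : (e p).frontier, colorType M (sub j t.label) =
      colorType M (part e p j x) := by
    intro j
    by_cases hj : j = i
    · subst hj
      rw [hti]
      exact hs.2.2
    · rw [htj j (((e p).frontierOf_iff j).2 j.2) fun h => hj (Subtype.ext h)]
      rfl
  have hsub : color M (e x).label (e p).label ⊆ color M t.label (e p).label := by
    refine accStates_subset M (T := (e p).nodes) (e p).prefix_closed (e p).root_mem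
      (PrefixClosed.pairLabel (e x).prefix_closed (e p).prefix_closed)
      (PrefixClosed.pairLabel t.prefix_closed (e p).prefix_closed)
      (pairLabel_ne_none.2 (Or.inl (e x).root_mem))
      (fun w hw => pairLabel_congr (htT w hw).symm rfl) fun s hs => ?_
    have hnone : sub s (e p).label = fun _ => none :=
      PrefixClosed.sub_eq_none (e p).prefix_closed (List.prefix_refl s) (not_not.1 hs.1)
    have h := congrArg Prod.fst (htype ⟨s, ((e p).frontierOf_iff s).1 hs⟩)
    change color M (sub s (e x).label) (sub s (e p).label) =
      color M (sub s t.label) (sub s (e p).label)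
    rw [hnone]
    exact h.symm
  obtain ⟨z, q, hzq, rfl, hq⟩ := hM.exists_le t (e p)
    ((hM.nonempty x p hx.1).mono (Set.inter_subset_inter_left _ hsub))
  obtain rfl := hM.injective hq
  refine ⟨z, ⟨hzq, ?_⟩, hti, fun j hj => ?_⟩
  · rw [← hx.2]
    exact Prod.ext (funext fun w => htT w w.2) (funext htype)
  · exact htj j (((e p).frontierOf_iff j).2 j.2) fun h => hj (Subtype.ext h)

theorem isBox_piece (hM : Recognizes M e) :
    IsBox (piece M e p k) (part e p) (color M) where
  order x hx y hy x' hx' y' hy' hc hxy := by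
    refine hM.le_of_color_subset hxy ?_
    refine accStates_subset M (T := (e p).nodes) (e p).prefix_closed (e p).root_mem
      (PrefixClosed.pairLabel (e x).prefix_closed (e y).prefix_closed)
      (PrefixClosed.pairLabel (e x').prefix_closed (e y').prefix_closed)
      (pairLabel_ne_none.2 (Or.inl (e x).root_mem))
      (fun w hw => pairLabel_congr (piece_label_eq hx hx' hw) (piece_label_eq hy hy' hw))
      fun s hs => hc ⟨s, ((e p).frontierOf_iff s).1 hs⟩
  mix x hx y hy i := by
    refine hM.exists_replace hx i ?_ ?_
    · rw [piece_colorType_eq hx hy]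
      exact sub_mem_component M (e y) i
    · obtain ⟨⟨v, hv, b, hvb⟩, -⟩ := i.2
      by_cases h : (e y).label v = none
      · exact Or.inl (part_eq_none i hvb h)
      · refine Or.inr fun v' b' hv' => ?_
        rw [← (List.append_inj' (hvb.symm.trans hv') rfl).1, piece_label_eq hx hy hv]
        exact h
  diag x hx y hy i := congrArg Prod.snd (piece_colorType_eq hx hy i)

/-- Inserting labelings as the `i`-th part of a fixed `x₀` maps the whole component into `Set.Iic
p`, strictly increasing for `colorLT M f`. So this relation has rank at most `γ`, and `hb` improves
the bound to `α`. -/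
theorem exists_heights (hM : Recognizes M e) {α γ : Ordinal.{u}} (hα : 0 < α)
    (hb : ∀ τ f, RankLE (colorLT M f) (component M τ) γ → RankLE (colorLT M f) (component M τ) α)
    (hγ : RankLE (· < ·) (Set.Iic p) γ) (i : (e p).frontier) :
    ∃ h : (List Bool → Option A) → Ordinal.{u},
      (∀ a b, SliceLE (piece M e p k) (part e p) i a b → a ≠ b → h a < h b) ∧
      ∀ x ∈ piece M e p k, h (part e p i x) < α := by
  rcases Set.eq_empty_or_nonempty (piece M e p k) with hemp | ⟨x₀, hx₀⟩
  · refine ⟨fun _ => 0, ?_, fun _ _ => hα⟩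
    rintro _ _ ⟨x, hx, -⟩ -
    rw [hemp] at hx
    exact absurd hx (Set.notMem_empty x)
  obtain ⟨⟨v, hv, b, hvb⟩, -⟩ := id i.2
  -- If the parent of the frontier word is not a node, only the empty part can hang there and the
  -- coordinate is constant on the piece.
  by_cases h0 : (e x₀).label v = none
  · have hnone : ∀ x ∈ piece M e p k, part e p i x = fun _ => none := fun x hx =>
      part_eq_none i hvb ((piece_label_eq hx hx₀ hv).trans h0)
    refine ⟨fun _ => 0, ?_, fun _ _ => hα⟩
    rintro _ _ ⟨x, hx, y, hy, rfl, rfl, -⟩ hne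
    exact absurd ((hnone x hx).trans (hnone y hy).symm) hne
  have hbox := hM.isBox_piece (p := p) (k := k)
  -- Recording only the colours of comparable pairs, instead of the slice order itself, leaves
  -- finitely many possible relations for all `p` together.
  let f : Set (Set Q) := {d | ∃ x ∈ piece M e p k, ∃ y ∈ piece M e p k,
    (∀ j, j ≠ i → part e p j x = part e p j y) ∧ x ≤ y ∧
      color M (part e p i x) (part e p i y) = d}
  let τ := colorType M (part e p i x₀)
  have hz : ∀ s, ∃ z, s ∈ component M τ → z ∈ piece M e p k ∧ part e p i z = s ∧
      ∀ j, j ≠ i → part e p j z = part e p j x₀ := by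
    intro s
    by_cases hs : s ∈ component M τ
    · obtain ⟨z, h⟩ := hM.exists_replace hx₀ i hs <| Or.inr fun v' b' hv' => by
        rwa [← (List.append_inj' (hvb.symm.trans hv') rfl).1]
      exact ⟨z, fun _ => h⟩
    · exact ⟨x₀, fun h => absurd h hs⟩
  choose z hz using hz
  have hmem : ∀ x ∈ piece M e p k, part e p i x ∈ component M τ := by
    intro x hx
    have := sub_mem_component M (e x) i
    change part e p i x ∈ component M (colorType M (part e p i x)) at this
    rwa [piece_colorType_eq hx hx₀] at this
  have hrank : RankLE (colorLT M f) (component M τ) γ := by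
    obtain ⟨g, hg, hgγ⟩ := hγ
    refine ⟨fun s => g (z s), fun s hs s' hs' hlt => ?_, fun s hs => hgγ _ (hz s hs).1.1⟩
    obtain ⟨hzs, hzi, hzj⟩ := hz s hs
    obtain ⟨hzs', hzi', hzj'⟩ := hz s' hs'
    obtain ⟨⟨x, hx, y, hy, hxy, hle, hc⟩, hne⟩ := hlt
    refine hg _ hzs.1 _ hzs'.1 (lt_of_le_of_ne ?_ fun h => hne (by rw [← hzi, ← hzi', h]))
    refine hbox.order x hx y hy _ hzs _ hzs' (fun j => ?_) hle
    by_cases hj : j = i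
    · subst hj
      rw [hzi, hzi', hc]
    · rw [← hxy j hj, hzj' j hj, ← hzj j hj]
      exact hbox.diag x hx _ hzs j
  obtain ⟨h, hh, hhα⟩ := hb τ f hrank
  refine ⟨h, ?_, fun x hx => hhα _ (hmem x hx)⟩
  rintro _ _ ⟨x, hx, y, hy, rfl, rfl, hxy, hle⟩ hne
  exact hh _ (hmem x hx) _ (hmem y hy) ⟨⟨x, hx, y, hy, hxy, hle, rfl⟩, hne⟩

end Recognizes

/-- In a tree-automatic well-founded order, each principal ideal is a finite union of boxes whose
coordinates range over finitely many orders. The ranks of those of them that lie below some `b n`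
are uniformly bounded by one value `b m`. -/
theorem exists_box_decomposition [WellFoundedLT P] (hP : IsTreeAutomaticOrder P)
    {b : ℕ → Ordinal.{u}} (hb : Monotone b) (hpos : 0 < b 0) :
    ∃ (C D : Type) (_ : Finite D) (δ : C → C → D) (m : ℕ), ∀ p : P,
      (∃ n, succ (IsWellFounded.rank (α := P) (· < ·) p) ≤ b n) →
      ∃ (ι K : Type) (_ : Finite ι) (_ : Finite K) (X : K → Set P) (π : ι → P → C),
        Set.Iic p ⊆ ⋃ k, X k ∧ ∀ k, IsBox (X k) π δ ∧
          ∃ h : ι → C → Ordinal.{u},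
            (∀ i a b, SliceLE (X k) π i a b → a ≠ b → h i a < h i b) ∧
            ∀ i, ∀ x ∈ X k, h i (π i x) < b m := by
  obtain ⟨A, _, e, he, -, Q, _, M, hM⟩ := hP
  have hrec := recognizes_of_language he hM
  -- For each of the finitely many relations, `n` is an index that bounds its rank, if there is one;
  -- otherwise the premise never holds and `0` will do.
  have hn : ∀ q : (Set Q × Set Q) × Set (Set Q), ∃ n : ℕ, ∀ n',
      RankLE (colorLT M q.2) (component M q.1) (b n') →
        RankLE (colorLT M q.2) (component M q.1) (b n) := by
    intro q
    by_cases h : ∃ n, RankLE (colorLT M q.2) (component M q.1) (b n)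
    · obtain ⟨n, hn⟩ := h
      exact ⟨n, fun _ _ => hn⟩
    · exact ⟨0, fun n' h' => absurd ⟨n', h'⟩ h⟩
  choose n hn using hn
  obtain ⟨m, hm⟩ := (Set.finite_range n).bddAbove
  refine ⟨List Bool → Option A, Set Q, inferInstance, color M, m, fun p ⟨n', hn'⟩ => ?_⟩
  have : Finite (e p).nodes := (e p).finite_nodes
  have : Finite (e p).frontier := (e p).finite_frontier
  refine ⟨(e p).frontier, _, inferInstance, inferInstance, Recognizes.piece M e p,
    part e p, fun x hx => Set.mem_iUnion.2 ⟨_, hx, rfl⟩, fun k =>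
    ⟨hrec.isBox_piece, ?_⟩⟩
  have hheights := fun i => hrec.exists_heights (p := p) (k := k) (α := b m) (γ := b n')
    (hpos.trans_le (hb (Nat.zero_le m)))
    (fun τ f h => (hn (τ, f) n' h).mono (hb (hm ⟨(τ, f), rfl⟩))) ((rankLE_Iic p).mono hn') i
  choose h hmono hα using hheights
  exact ⟨h, hmono, hα⟩

end Pieces

/-! ### The rank bounds -/

section Main

variable {P : Type u} [PartialOrder P]

theorem exists_rank_eq [WellFoundedLT P] {o : Ordinal.{u}} (h : o < orderRank P) :
    ∃ p : P, IsWellFounded.rank (α := P) (· < ·) p = o := by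
  obtain ⟨q, hq⟩ := Ordinal.lt_iSup_iff.1 h
  exact IsWellFounded.mem_range_rank_of_le (lt_succ_iff.1 hq)

theorem IsUpwardsLinear.le_or_le (h : IsUpwardsLinear P) (x y z : P) (hxy : x ≤ y) (hxz : x ≤ z) :
    y ≤ z ∨ z ≤ y := by
  rcases hxy.eq_or_lt with rfl | hxy
  · exact Or.inl hxz
  rcases hxz.eq_or_lt with rfl | hxz
  · exact Or.inr hxy.le
  exact (h x).total hxy hxz

theorem orderRank_lt_of_boxes [WellFoundedLT P] (hP : IsTreeAutomaticOrder P)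
    {s : ℕ → Ordinal.{u}} (hs : StrictMono s) {β : Ordinal.{u}} (hβ : ∀ n, ω ^ s n < β)
    (hbox : ∀ (ι C D : Type) [Fintype ι] [Finite D] (X : Set P) (π : ι → P → C) (δ : C → C → D)
      (m : ℕ) (h : ι → C → Ordinal.{u}), IsBox X π δ →
      (∀ i a b, SliceLE X π i a b → a ≠ b → h i a < h i b) →
      (∀ i, ∀ x ∈ X, h i (π i x) < ω ^ s m) → ∃ α < ω ^ s (m + 2), RankLE (· < ·) X α) :
    orderRank P < β := by
  by_contra hcon
  have hb : StrictMono fun n => (ω : Ordinal.{u}) ^ s n := fun n m hnm =>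
    (Ordinal.opow_lt_opow_iff_right Ordinal.one_lt_omega0).2 (hs hnm)
  obtain ⟨C, D, _, δ, m, hm⟩ := exists_box_decomposition hP hb.monotone
    (Ordinal.opow_pos _ Ordinal.omega0_pos)
  obtain ⟨p, hp⟩ := exists_rank_eq ((hβ (m + 2)).trans_le (not_lt.1 hcon))
  -- The index `m + 3` only certifies that the rank of `p` is below some `b n`; the heights obtained
  -- are below `b m` regardless.
  obtain ⟨ι, K, _, _, X, π, hcover, hX⟩ := hm p ⟨m + 3, by
    rw [hp]
    exact succ_le_of_lt (hb (Nat.lt_succ_self _))⟩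
  have := Fintype.ofFinite ι
  obtain ⟨α, hα, hr⟩ := rankLE_iUnion (S := X) (s := s (m + 2))
    (zero_le.trans_lt (hs (Nat.lt_succ_self (m + 1)))).ne'
    (fun k => by
      obtain ⟨hk, h, hmono, hh⟩ := hX k
      exact hbox ι C D (X k) π δ m h hk hmono hh) hcover
  exact (hr.rank_lt.trans hα).ne hp

theorem orderRank_lt_of_upwardsLinear [WellFoundedLT P] (hP : IsTreeAutomaticOrder P)
    (hlin : IsUpwardsLinear P) : orderRank P < ω ^ ((ω : Ordinal.{u}) ^ (ω : Ordinal.{u})) := by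
  have hs : StrictMono fun n : ℕ => (ω : Ordinal.{u}) ^ (n : Ordinal.{u}) := fun n m hnm =>
    (Ordinal.opow_lt_opow_iff_right Ordinal.one_lt_omega0).2 (Nat.cast_lt.2 hnm)
  refine orderRank_lt_of_boxes hP hs (fun n => ?_) ?_
  · rw [Ordinal.opow_lt_opow_iff_right Ordinal.one_lt_omega0,
      Ordinal.opow_lt_opow_iff_right Ordinal.one_lt_omega0]
    exact Ordinal.natCast_lt_omega0 n
  · intro ι C D _ _ X π δ m h hX hmono hh
    refine ⟨_, ?_, hX.rankLE hlin.le_or_le hmono hh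
      (hX.rankLE_region hlin.le_or_le hmono hh)⟩
    have hlim : ∀ {a c : Ordinal.{u}}, c ≠ 0 → a < ω ^ c → succ a < ω ^ c := fun hc ha =>
      (Ordinal.isSuccLimit_opow_left Ordinal.isSuccLimit_omega0 hc).succ_lt ha
    have hm : (ω : Ordinal.{u}) ^ (m : Ordinal.{u}) < ω ^ ((m + 2 : ℕ) : Ordinal.{u}) :=
      hs (by omega)
    have hm0 : ((m + 2 : ℕ) : Ordinal.{u}) ≠ 0 := by exact_mod_cast Nat.succ_ne_zero (m + 1)
    -- The target is closed under multiplication, so the region factor and the history factor can be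
    -- bounded separately.
    refine Ordinal.isPrincipal_mul_omega0_opow_opow _ ?_ ?_
    · rw [Ordinal.opow_lt_opow_iff_right Ordinal.one_lt_omega0]
      exact hlim hm0 (NatOrd.sum_lt_omega0_opow _ fun _ _ => NatOrd.of_lt_of.2 hm)
    · refine hlim (Ordinal.opow_ne_zero _ Ordinal.omega0_ne_zero)
        (NatOrd.sum_lt_omega0_opow _ fun _ _ => NatOrd.nsmul_lt_omega0_opow _ ?_)
      exact (Ordinal.opow_lt_opow_iff_right Ordinal.one_lt_omega0).2 hm

theorem orderRank_lt_of_forest [WellFoundedLT P] (hP : IsTreeAutomaticOrder P)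
    (hfor : IsForest P) : orderRank P < (ω : Ordinal.{u}) ^ (ω : Ordinal.{u}) := by
  have hs : StrictMono fun n : ℕ => (n : Ordinal.{u}) := fun n m hnm => Nat.cast_lt.2 hnm
  refine orderRank_lt_of_boxes hP hs (fun n => ?_) ?_
  · rw [Ordinal.opow_lt_opow_iff_right Ordinal.one_lt_omega0]
    exact Ordinal.natCast_lt_omega0 n
  · intro ι C D _ _ X π δ m h hX hmono hh
    have hfin : ∀ x : P, (Set.Ici x).Finite := fun x => by
      rw [← Set.Ioi_insert]
      exact (hfor.2 x).insert x
    refine ⟨_, ?_, hX.rankLE hfor.1.le_or_le hmono hh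
      fun A => rankLE_omega0_of_finite (hX.region_finite hfin A)⟩
    -- The finite regions contribute the left factor `ω`, hence a `1` on the left of the exponent;
    -- the history factor stays below `ω ^ (m + 1)`.
    have hm : ((m + 2 : ℕ) : Ordinal.{u}) = 1 + ((m + 1 : ℕ) : Ordinal.{u}) := by
      rw [show m + 2 = 1 + (m + 1) by omega, Nat.cast_add, Nat.cast_one]
    rw [hm, Ordinal.opow_one_add]
    refine mul_lt_mul_of_pos_left ?_ Ordinal.omega0_pos
    refine (Ordinal.isSuccLimit_opow_left Ordinal.isSuccLimit_omega0
      (by exact_mod_cast Nat.succ_ne_zero m)).succ_lt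
      (NatOrd.sum_lt_omega0_opow _ fun _ _ => NatOrd.nsmul_lt_omega0_opow _ ?_)
    exact (Ordinal.opow_lt_opow_iff_right Ordinal.one_lt_omega0).2 (hs (Nat.lt_succ_self m))

end Main

end TreeAutomatic

theorem mainTheorem1 (P : Type u) [PartialOrder P] [WellFoundedLT P]
    (hP : TreeAutomatic.IsTreeAutomaticOrder P) :
    (TreeAutomatic.IsUpwardsLinear P →
      TreeAutomatic.orderRank P < (ω : Ordinal.{u}) ^ ((ω : Ordinal.{u}) ^ (ω : Ordinal.{u}))) ∧
    (TreeAutomatic.IsForest P →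
      TreeAutomatic.orderRank P < (ω : Ordinal.{u}) ^ (ω : Ordinal.{u})) ∧
    (TreeAutomatic.IsOrderTree P →
      TreeAutomatic.orderRank P < (ω : Ordinal.{u}) ^ (ω : Ordinal.{u})) :=
  ⟨TreeAutomatic.orderRank_lt_of_upwardsLinear hP, TreeAutomatic.orderRank_lt_of_forest hP,
    fun h => TreeAutomatic.orderRank_lt_of_forest hP h.1⟩
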